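/- Let $\mathbb{H}^2$ be the hyperbolic plane with geodesic polar coordinates $(r,\theta)$ about a fixed origin, metric $dr^2+\sinh^2 r\,d\theta^2$, and let $\mathbb{S}^2\subset\mathbb{R}^3$ be the unit sphere, $\vec i,\vec j,\vec k$ the standard basis of $\mathbb{R}^3$, and $e^{\theta R}$ the rotation of $\mathbb{R}^3$ by the angle $\theta$ about the $\vec k$-axis. A map $u:\mathbb{H}^2\to\mathbb{S}^2$ is 1-equivariant if it commutes with rotations, i.e. $u(r,\theta)=e^{\theta R}\bar u(r)$; such maps are always taken continuous, with $\bar u$ locally absolutely continuous on $(0,\infty)$. Put $E(u)=\frac12\int_{\mathbb{H}^2}|du|^2\,d\mathrm{vol}$ and $$\mathcal{V}^+=\partial_r u+\frac{u\times(\vec k\times u)}{\sinh r}.$$ A (normalized) Coulomb frame for $u$ is a frame $v=e^{\theta R}\bar v(r)$, $w=e^{\theta R}\bar w(r)$, $r>0$, with $\bar v$ locally absolutely continuous on $(0,\infty)$, $|v|=1$, $v\cdot u=0$, $w=u\times v$, $\partial_r\bar v\cdot\bar w=0$ for a.e. $r$, and $\bar v(r)\to\vec i$, $\bar w(r)\to\vec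 j$ as $r\to\infty$. A function $\psi^+:(0,\infty)\to\mathbb{C}$ is the Coulomb-gauge representation of $\mathcal{V}^+$ if $\psi^+=\mathcal{V}^+\cdot v+i\,\mathcal{V}^+\cdot w$ almost everywhere for such a frame. Radial functions are measured by $\|\psi\|_{L^2}^2=\int_0^\infty|\psi(r)|^2\sinh r\,dr$. **Proposition.** For every radial $\psi^+\in L^2$ (complex valued) with $\|\psi^+\|_{L^2}<2$ there is a unique 1-equivariant map $u:\mathbb{H}^2\to\mathbb{S}^2$ for which $\psi^+$ is the Coulomb-gauge representation of $\mathcal{V}^+$. This map has finite energy, satisfies $\lim_{r\to0}u_3=\lim_{r\to\infty}u_3=1$, and $$E(u)=\pi\|\psi^+\|_{L^2}^2 .$$ Moreover there is an absolute constant $C>0$ such that for all $\psi^+,\tilde\psi^+$ in the open ball of radius $2$ of radial $L^2$, the corresponding maps $u,\tilde u$ satisfy $$\|u-\tilde u\|_{\dot H^1}\le C\,\|\psi^+-\tilde\psi^+\|_{L^2},\qquad \|u-\tilde u\|_{\dot H^1}^2=\int_{\mathbb{H}^2}|d(u-\tilde u)|^2\,d\mathrm{vol}.$$ -/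

import Mathlib

open MeasureTheory Filter Topology Set
open scoped ENNReal Matrix

noncomputable section

/-- Euclidean three-space. -/
abbrev E3 : Type := EuclideanSpace ℝ (Fin 3)

/-- The hyperbolic plane `ℍ²`, the upper sheet of the hyperboloid in Minkowski space. -/
abbrev HypPlane : Type :=
  {x : E3 // x 2 ^ 2 - x 0 ^ 2 - x 1 ^ 2 = 1 ∧ 0 < x 2}

/-- The round unit sphere `𝕊² ⊂ ℝ³`. -/
abbrev Sphere2 : Type := Metric.sphere (0 : E3) 1

/-- The standard basis vectors `i, j, k` of `ℝ³`. -/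
def vecI : E3 := !₂[1, 0, 0]

def vecJ : E3 := !₂[0, 1, 0]

def vecK : E3 := !₂[0, 0, 1]

/-- The cross product on `ℝ³`. -/
def cross3 (a b : E3) : E3 := WithLp.toLp 2 (a.ofLp ⨯₃ b.ofLp)

/-- The horizontal rotation `e^{θR}` of `ℝ³`, where `R x = k × x`. -/
def rot3 (θ : ℝ) (x : E3) : E3 :=
  !₂[Real.cos θ * x 0 - Real.sin θ * x 1, Real.sin θ * x 0 + Real.cos θ * x 1, x 2]

/-- The rotation by the angle `θ` of `ℍ²` about its origin `(0, 0, 1)`. -/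
def rotHyp (θ : ℝ) (x : HypPlane) : HypPlane :=
  ⟨rot3 θ x.1, by
    obtain ⟨x, hx, hpos⟩ := x
    have h := Real.sin_sq_add_cos_sq θ
    refine ⟨?_, by simpa [rot3] using hpos⟩
    simp only [rot3, PiLp.toLp_apply, Matrix.cons_val]
    linear_combination hx - (x 0 ^ 2 + x 1 ^ 2) * h⟩

/-- Geodesic polar coordinates on `ℍ²`; the metric is `dr² + sinh² r dθ²`. -/
def polarHyp (r θ : ℝ) : HypPlane :=
  ⟨!₂[Real.sinh r * Real.cos θ, Real.sinh r * Real.sin θ, Real.cosh r], by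
    have h := Real.sin_sq_add_cos_sq θ
    have h' := Real.cosh_sq r
    refine ⟨?_, by simpa using Real.cosh_pos r⟩
    simp only [Matrix.cons_val]
    linear_combination h' - Real.sinh r ^ 2 * h⟩

/-- The measure `sinh r dr` on `(0, ∞)`. Radial functions on `ℍ²` are identified with functions
of `r > 0`, and `L²` of radial functions is `L²` of this measure. -/
def radialMeasure : Measure ℝ :=
  (volume.restrict (Ioi 0)).withDensity fun r => ENNReal.ofReal (Real.sinh r)

/-- A curve defined on `(0, ∞)` is locally absolutely continuous there. -/
def LocallyACOnPos (f : ℝ → E3) : Prop :=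
  ∀ a b : ℝ, 0 < a → a ≤ b → AbsolutelyContinuousOnInterval f a b

/-- The Dirichlet integral `∫_{ℍ²} |df|² dvol` in geodesic polar coordinates, that is with
`|df|² = |∂_r f|² + |∂_θ f|² / sinh² r` and `dvol = sinh r dr dθ`. It is used only for maps that
are locally absolutely continuous along the coordinate lines, for which the classical partial
derivatives exist almost everywhere and are the weak ones. -/
def dirichletIntegral (f : HypPlane → E3) : ℝ≥0∞ :=
  ∫⁻ r in Ioi (0 : ℝ), ∫⁻ θ in Ioc (0 : ℝ) (2 * Real.pi),
    ENNReal.ofReal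
      ((‖deriv (fun s => f (polarHyp s θ)) r‖ ^ 2
        + ‖deriv (fun t => f (polarHyp r t)) θ‖ ^ 2 / Real.sinh r ^ 2) * Real.sinh r)

/-- The energy `E(u) = ½ ∫ |du|² dvol`. -/
def mapEnergy (u : HypPlane → Sphere2) : ℝ≥0∞ :=
  2⁻¹ * dirichletIntegral fun x => (u x : E3)

/-- The distance `‖u - u'‖` in the homogeneous Sobolev space `Ḣ¹(ℍ²; ℝ³)`. -/
def dotH1Dist (u u' : HypPlane → Sphere2) : ℝ≥0∞ :=
  (dirichletIntegral fun x => (u x : E3) - (u' x : E3)) ^ (1 / 2 : ℝ)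

/-- The radial profile `ū(r) = u(r, 0)`. -/
def radialProfile (u : HypPlane → Sphere2) (r : ℝ) : E3 := u (polarHyp r 0)

/-- The continuous 1-equivariant maps `ℍ² → 𝕊²`, `u ∘ ρ = ρ ∘ u` for all rotations `ρ`, with
locally absolutely continuous radial profile. -/
structure IsOneEquivariant (u : HypPlane → Sphere2) : Prop where
  equivariant : ∀ (θ : ℝ) (x : HypPlane), (u (rotHyp θ x) : E3) = rot3 θ (u x)
  continuous : Continuous u
  locallyAC : LocallyACOnPos (radialProfile u)

/-- The class `𝓔₀`: finite energy, and `u₃ → 1` both at the origin and at infinity. -/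
structure InClassE0 (u : HypPlane → Sphere2) : Prop where
  finite_energy : mapEnergy u < ⊤
  tendsto_zero : Tendsto (fun r => radialProfile u r 2) (𝓝[>] 0) (𝓝 1)
  tendsto_infty : Tendsto (fun r => radialProfile u r 2) atTop (𝓝 1)

/-- The vector field `𝓥⁺ = ∂_r u + u × (k × u) / sinh r` at the point `(r, θ)`. -/
def fieldVPlus (u : HypPlane → Sphere2) (r θ : ℝ) : E3 :=
  deriv (fun s => (u (polarHyp s θ) : E3)) r
    + (Real.sinh r)⁻¹ • cross3 (u (polarHyp r θ)) (cross3 vecK (u (polarHyp r θ)))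

/-- `(v, w)` is the profile on `(0, ∞)` of a 1-equivariant orthonormal frame
`(e^{θR} v(r), e^{θR} w(r))` of `u^* T𝕊²` in the Coulomb gauge `A₁ = ∂_r v ⬝ w = 0`, normalized
by `v(∞) = i`, `w(∞) = j`. -/
structure IsCoulombFrame (u : HypPlane → Sphere2) (v w : ℝ → E3) : Prop where
  locallyAC : LocallyACOnPos v
  unit : ∀ r, 0 < r → ‖v r‖ = 1
  tangent : ∀ r, 0 < r → inner ℝ (v r) (radialProfile u r) = 0
  oriented : ∀ r, 0 < r → w r = cross3 (radialProfile u r) (v r)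
  coulomb : ∀ᵐ r ∂(volume.restrict (Ioi 0)), inner ℝ (deriv v r) (w r) = 0
  tendsto_v : Tendsto v atTop (𝓝 vecI)
  tendsto_w : Tendsto w atTop (𝓝 vecJ)

/-- `ψ` is the representation of `𝓥⁺` in a normalized Coulomb frame:
`ψ = 𝓥⁺ ⬝ v + i 𝓥⁺ ⬝ w`. -/
def IsCoulombRepresentation (u : HypPlane → Sphere2) (ψ : ℝ → ℂ) : Prop :=
  ∃ v w : ℝ → E3, IsCoulombFrame u v w ∧
    ∀ θ : ℝ, ∀ᵐ r ∂(volume.restrict (Ioi 0)),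
      ψ r = (inner ℝ (fieldVPlus u r θ) (rot3 θ (v r)) : ℂ)
        + Complex.I * (inner ℝ (fieldVPlus u r θ) (rot3 θ (w r)) : ℂ)

end

/-! The tangential part of `k` has components `v₃`, `w₃` in the frame, so `∂_r u = α v + β w` with
`α + iβ = ψ - (v₃ + i w₃) / sinh r`, and the Coulomb condition gives `v' = -α u`, `w' = -β u`. A map
together with its normalized frame is thus a solution of `FrameODE`, with data at infinity
(`IsOneEquivariant.exists_frameODE`, `FrameODE.exists_map`). What remains is well-posedness from
infinity and the behaviour at the singular endpoint `r = 0`.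

Energy. Put `a = α + iβ` and `b = (v₃ + i w₃) / sinh r`. Then `ψ = a + b` and `u₃' = (a ⬝ b) sinh
r`, so the energy density `(|a|² + |b|²) sinh r` equals `|ψ|² sinh r - 2 u₃'`. From `4 a ⬝ b ≤ |a +
b|²` one gets `u₃ ≥ 1 - ‖ψ‖² / 4`, which is positive exactly because `‖ψ‖ < 2`. Hence the energy is
finite; as `1 / sinh r` is not integrable at `0`, the horizontal part of `u` must vanish there, and
positivity selects `u₃ → 1`. The boundary terms then cancel, leaving the energy equality
(`FrameODE.tendsto_u_zero`, `FrameODE.integral_frameEnergy_eq`).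

Existence. The vertical components `(u₃, v₃, w₃)` move on a sphere, and their stereographic
coordinate `ζ` solves the Riccati equation `ζ' = ζ / sinh r - ψ / 2 - ψ̄ ζ² / 2`. Writing `ζ = x /
y` lifts this to a linear system in `ℂ²`, solved from infinity by a weighted contraction;
normalizing the solution gives the whole frame (`exists_integral_solution`, `IsSpinor.frameODE`).

Stability. The squared difference `ρ` of the vertical components of two solutions satisfies `ρ' ≥ ρ
/ sinh r - kρ - |ψ - ψ'|² sinh r`, where `k` is the sum of the vertical energy densities and has
integral at most `12`. The favourable sign of `ρ / sinh r` depends on `u₃, u₃' > 0`. Since `ρ → 0`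
at infinity, a backward Grönwall inequality controls both `ρ` and `∫ ρ / sinh r`
(`FrameODE.vertical_diff_bound`). The horizontal components are then handled by `u = v × w`: each
term of `u₀`, `u₁` contains a vertical component, so the singular terms are either already bounded
or carry an integrable weight (`FrameODE.horizontal_diff_bound`). Uniqueness is the case `ψ = ψ'`.
-/

/-! ### Absolutely continuous functions, Grönwall and improper integrals on `(0, ∞)`. -/

theorem AbsolutelyContinuousOnInterval.lipschitzOn_comp {X Y : Type*} [PseudoMetricSpace X]
    [PseudoMetricSpace Y] {f : ℝ → X} {φ : X → Y} {K : NNReal} {s : Set X} {a b : ℝ}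
    (hf : AbsolutelyContinuousOnInterval f a b) (hφ : LipschitzOnWith K φ s)
    (hs : MapsTo f (uIcc a b) s) : AbsolutelyContinuousOnInterval (fun x => φ (f x)) a b := by
  unfold AbsolutelyContinuousOnInterval at hf ⊢
  refine squeeze_zero' (Eventually.of_forall fun _ => Finset.sum_nonneg fun i _ => dist_nonneg) ?_
    (by simpa using hf.const_mul (K : ℝ))
  rw [eventually_inf_principal]
  filter_upwards with E hE
  rw [Finset.mul_sum]
  refine Finset.sum_le_sum fun i hi => ?_
  have h := hE.1 i hi
  exact hφ.dist_le_mul _ (hs h.1) _ (hs h.2)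

theorem AbsolutelyContinuousOnInterval.exp {f : ℝ → ℝ} {a b : ℝ}
    (hf : AbsolutelyContinuousOnInterval f a b) :
    AbsolutelyContinuousOnInterval (fun x => Real.exp (f x)) a b := by
  obtain ⟨C, hC⟩ := hf.exists_bound
  obtain ⟨K, hK⟩ := (Real.contDiff_exp (n := 1)).contDiffOn.exists_lipschitzOnWith
    (s := Icc (-C) C) (by decide) (convex_Icc _ _) isCompact_Icc
  exact hf.lipschitzOn_comp hK fun x hx => abs_le.1 (hC x hx)

theorem AbsolutelyContinuousOnInterval.inv {f : ℝ → ℝ} {a b : ℝ}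
    (hf : AbsolutelyContinuousOnInterval f a b) (hpos : ∀ x ∈ uIcc a b, 0 < f x) :
    AbsolutelyContinuousOnInterval (fun x => (f x)⁻¹) a b := by
  obtain ⟨c, hc, hmin⟩ := isCompact_uIcc.exists_isMinOn (nonempty_uIcc (a := a) (b := b))
    hf.continuousOn
  obtain ⟨C, hC⟩ := hf.exists_bound
  have hd : ContDiffOn ℝ 1 (fun y : ℝ => y⁻¹) (Icc (f c) C) :=
    contDiffOn_id.inv fun y hy => ((hpos c hc).trans_le hy.1).ne'
  obtain ⟨K, hK⟩ := hd.exists_lipschitzOnWith (by decide) (convex_Icc _ _) isCompact_Icc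
  exact hf.lipschitzOn_comp hK fun x hx => ⟨hmin hx, (le_abs_self _).trans (hC x hx)⟩

theorem absolutelyContinuousOnInterval_const {X : Type*} [PseudoMetricSpace X] (c : X) (a b : ℝ) :
    AbsolutelyContinuousOnInterval (fun _ : ℝ => c) a b :=
  (LipschitzWith.const c).lipschitzOnWith.absolutelyContinuousOnInterval

/-- Real functions that are absolutely continuous on compact subintervals of `(0, ∞)`. -/
def ACOnPos (f : ℝ → ℝ) : Prop :=
  ∀ a b : ℝ, 0 < a → a ≤ b → AbsolutelyContinuousOnInterval f a b

namespace ACOnPos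

variable {f g : ℝ → ℝ}

theorem add (hf : ACOnPos f) (hg : ACOnPos g) : ACOnPos fun r => f r + g r :=
  fun a b ha hab => (hf a b ha hab).add (hg a b ha hab)

theorem sub (hf : ACOnPos f) (hg : ACOnPos g) : ACOnPos fun r => f r - g r :=
  fun a b ha hab => (hf a b ha hab).sub (hg a b ha hab)

theorem mul (hf : ACOnPos f) (hg : ACOnPos g) : ACOnPos fun r => f r * g r :=
  fun a b ha hab => (hf a b ha hab).mul (hg a b ha hab)

theorem const (c : ℝ) : ACOnPos fun _ => c :=
  fun a b _ _ => absolutelyContinuousOnInterval_const c a b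

theorem sq (hf : ACOnPos f) : ACOnPos fun r => f r ^ 2 := by
  simpa only [pow_two] using hf.mul hf

theorem inv (hf : ACOnPos f) (hpos : ∀ r, 0 < r → 0 < f r) : ACOnPos fun r => (f r)⁻¹ :=
  fun a b ha hab => (hf a b ha hab).inv fun x hx => hpos x
    (ha.trans_le (by rw [uIcc_of_le hab] at hx; exact hx.1))

theorem continuousOn (hf : ACOnPos f) : ContinuousOn f (Ioi 0) := by
  intro x hx
  have hx : 0 < x := hx
  have h := (hf (x / 2) (x + 1) (by positivity) (by linarith)).continuousOn
  rw [uIcc_of_le (by linarith)] at h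
  exact (h.continuousAt (Icc_mem_nhds (by linarith) (by linarith))).continuousWithinAt

theorem ae_differentiableAt (hf : ACOnPos f) :
    ∀ᵐ r ∂(volume.restrict (Ioi (0 : ℝ))), DifferentiableAt ℝ f r := by
  rw [ae_restrict_iff' measurableSet_Ioi]
  have h : ∀ n : ℕ, ∀ᵐ x : ℝ, x ∈ uIcc (1 / ((n : ℝ) + 1)) (n + 1) → DifferentiableAt ℝ f x :=
    fun n => (hf _ _ (by positivity) (by
      rw [div_le_iff₀ (by positivity)]
      nlinarith [(Nat.cast_nonneg n : (0 : ℝ) ≤ n)])).ae_differentiableAt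
  filter_upwards [ae_all_iff.2 h] with x hx hx0
  have hx0 : 0 < x := hx0
  obtain ⟨n, hn⟩ := exists_nat_gt (max x (1 / x))
  have h1 : x < n := (le_max_left _ _).trans_lt hn
  have h2 : 1 / x < n := (le_max_right _ _).trans_lt hn
  refine hx n ?_
  rw [mem_uIcc]
  left
  refine ⟨?_, by linarith⟩
  rw [div_le_iff₀ (by positivity)]
  rw [div_lt_iff₀ hx0] at h2
  nlinarith

end ACOnPos

/-- The fundamental theorem of calculus on compact subintervals of `(0, ∞)`. -/
theorem ACOnPos.integral_eq_sub {f f' : ℝ → ℝ} (hf : ACOnPos f)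
    (hf' : ∀ᵐ r ∂(volume.restrict (Ioi (0 : ℝ))), HasDerivAt f (f' r) r) {a b : ℝ}
    (ha : 0 < a) (hab : a ≤ b) :
    IntervalIntegrable f' volume a b ∧ ∫ r in a..b, f' r = f b - f a := by
  have hAC := hf a b ha hab
  have hae : ∀ᵐ r, r ∈ uIoc a b → deriv f r = f' r := by
    rw [ae_restrict_iff' measurableSet_Ioi] at hf'
    filter_upwards [hf'] with r hr hrm
    rw [uIoc_of_le hab] at hrm
    exact (hr (ha.trans hrm.1)).deriv
  refine ⟨hAC.intervalIntegrable_deriv.congr_ae ?_, ?_⟩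
  · rw [EventuallyEq, ae_restrict_iff' measurableSet_uIoc]
    exact hae
  · rw [← hAC.integral_deriv_eq_sub]
    exact (intervalIntegral.integral_congr_ae hae).symm

/-- Multiplication by the integrating factor `exp (∫ k)`. -/
theorem ACOnPos.integral_exp_mul {F F' k : ℝ → ℝ} (hF : ACOnPos F)
    (hF' : ∀ᵐ r ∂(volume.restrict (Ioi (0 : ℝ))), HasDerivAt F (F' r) r) {a b : ℝ}
    (ha : 0 < a) (hab : a ≤ b) (hk : IntervalIntegrable k volume a b) :
    IntervalIntegrable (fun r => Real.exp (∫ s in a..r, k s) * (F' r + k r * F r)) volume a b ∧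
    ∫ r in a..b, Real.exp (∫ s in a..r, k s) * (F' r + k r * F r)
      = Real.exp (∫ s in a..b, k s) * F b - F a := by
  have hg := (hk.absolutelyContinuousOnInterval_intervalIntegral (c := a) left_mem_uIcc).exp
  have hAC := hg.fun_mul (hF a b ha hab)
  have hae : ∀ᵐ r, r ∈ uIoc a b → deriv (fun r => Real.exp (∫ s in a..r, k s) * F r) r
      = Real.exp (∫ s in a..r, k s) * (F' r + k r * F r) := by
    rw [ae_restrict_iff' measurableSet_Ioi] at hF'
    filter_upwards [hF', hk.ae_hasDerivAt_integral] with r hr hkr hrm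
    have h1 := hkr (uIoc_subset_uIcc hrm) a left_mem_uIcc
    rw [uIoc_of_le hab] at hrm
    rw [(h1.exp.fun_mul (hr (ha.trans hrm.1))).deriv]
    ring
  refine ⟨hAC.intervalIntegrable_deriv.congr_ae ?_, ?_⟩
  · rw [EventuallyEq, ae_restrict_iff' measurableSet_uIoc]
    exact hae
  · rw [← intervalIntegral.integral_congr_ae hae, hAC.integral_deriv_eq_sub]
    simp

/-- A backward Grönwall inequality. -/
theorem ACOnPos.backward_gronwall {F F' f d k : ℝ → ℝ} {K : ℝ} (hF : ACOnPos F)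
    (hF' : ∀ᵐ r ∂(volume.restrict (Ioi (0 : ℝ))), HasDerivAt F (F' r) r)
    (hle : ∀ᵐ r ∂(volume.restrict (Ioi (0 : ℝ))), f r - k r * F r - d r ≤ F' r)
    {a b : ℝ} (ha : 0 < a) (hab : a ≤ b) (hFb : 0 ≤ F b)
    (hf0 : ∀ r, 0 < r → 0 ≤ f r) (hd0 : ∀ r, 0 < r → 0 ≤ d r) (hk0 : ∀ r, 0 < r → 0 ≤ k r)
    (hk : IntervalIntegrable k volume a b) (hf : IntervalIntegrable f volume a b)
    (hd : IntervalIntegrable d volume a b) (hK : ∫ r in a..b, k r ≤ K) :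
    F a + ∫ r in a..b, f r ≤ Real.exp K * (F b + ∫ r in a..b, d r) := by
  obtain ⟨hint, heq⟩ := hF.integral_exp_mul hF' ha hab hk
  have hg0 : ∀ r ∈ Icc a b, 0 ≤ ∫ s in a..r, k s := fun r hr =>
    intervalIntegral.integral_nonneg hr.1 fun s hs => hk0 s (ha.trans_le hs.1)
  have hgK : ∀ r ∈ Icc a b, ∫ s in a..r, k s ≤ K := fun r hr => by
    refine le_trans ?_ hK
    have h1 : IntervalIntegrable k volume a r := hk.mono_set (by
      rw [uIcc_of_le hab, uIcc_of_le hr.1]; exact Icc_subset_Icc_right hr.2)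
    have h2 : IntervalIntegrable k volume r b := hk.mono_set (by
      rw [uIcc_of_le hab, uIcc_of_le hr.2]; exact Icc_subset_Icc_left hr.1)
    rw [← intervalIntegral.integral_add_adjacent_intervals h1 h2]
    have := intervalIntegral.integral_nonneg (μ := volume) hr.2
      fun s hs => hk0 s (ha.trans_le (hr.1.trans hs.1))
    linarith
  have hmono : ∫ r in a..b, (f r - Real.exp K * d r)
      ≤ ∫ r in a..b, Real.exp (∫ s in a..r, k s) * (F' r + k r * F r) := by
    refine intervalIntegral.integral_mono_ae_restrict hab (hf.sub (hd.const_mul _)) hint ?_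
    have hsub : Icc a b ⊆ Ioi 0 := fun x hx => ha.trans_le hx.1
    filter_upwards [ae_restrict_of_ae_restrict_of_subset hsub hle,
      ae_restrict_mem measurableSet_Icc] with r hr hrm
    -- The integrating factor lies in `[1, exp K]`: the lower bound is spent on `f`, the upper bound
    -- on `d`.
    have e1 := Real.one_le_exp (hg0 r hrm)
    have e2 := Real.exp_le_exp.2 (hgK r hrm)
    have hfr := hf0 r (hsub hrm)
    have hdr := hd0 r (hsub hrm)
    have h3 : Real.exp (∫ s in a..r, k s) * (f r - d r)
        ≤ Real.exp (∫ s in a..r, k s) * (F' r + k r * F r) := by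
      gcongr
      linarith
    nlinarith
  rw [heq, intervalIntegral.integral_sub hf (hd.const_mul _),
    intervalIntegral.integral_const_mul] at hmono
  have h4 : Real.exp (∫ s in a..b, k s) * F b ≤ Real.exp K * F b := by
    gcongr
  linarith

theorem one_div_add_one_le (n : ℕ) : 1 / ((n : ℝ) + 1) ≤ (n : ℝ) + 1 := by
  rw [div_le_iff₀ (by positivity)]
  nlinarith [(Nat.cast_nonneg n : (0 : ℝ) ≤ n)]

/-- The exhaustion stays away from both `0` and `∞`, so identities from the fundamental theorem of
calculus on compact intervals pass to the half-line. -/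
theorem aecover_Ioc_one_div : AECover (volume.restrict (Ioi (0 : ℝ))) atTop
    fun n : ℕ => Ioc (1 / ((n : ℝ) + 1)) ((n : ℝ) + 1) := by
  have hb : Tendsto (fun n : ℕ => (n : ℝ) + 1) atTop atTop :=
    tendsto_atTop_add_const_right _ _ tendsto_natCast_atTop_atTop
  have h1 := aecover_Ioi_of_Ioi (μ := (volume : Measure ℝ))
    (tendsto_one_div_add_atTop_nhds_zero_nat (𝕜 := ℝ))
  have h2 := (aecover_Iic (μ := (volume : Measure ℝ)) hb).restrict (s := Ioi (0 : ℝ))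
  exact h1.inter h2

theorem restrict_Ioi_restrict_Ioc (n : ℕ) : (volume.restrict (Ioi (0 : ℝ))).restrict
    (Ioc (1 / ((n : ℝ) + 1)) ((n : ℝ) + 1))
    = volume.restrict (Ioc (1 / ((n : ℝ) + 1)) ((n : ℝ) + 1)) := by
  have hsub : Ioc (1 / ((n : ℝ) + 1)) ((n : ℝ) + 1) ⊆ Ioi 0 := fun x hx =>
    lt_trans (by positivity) hx.1
  rw [Measure.restrict_restrict measurableSet_Ioc, inter_eq_left.2 hsub]

theorem tendsto_intervalIntegral_Ioi {f : ℝ → ℝ} (hf : IntegrableOn f (Ioi 0)) :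
    Tendsto (fun n : ℕ => ∫ r in (1 / ((n : ℝ) + 1))..((n : ℝ) + 1), f r) atTop
      (𝓝 (∫ r in Ioi 0, f r)) := by
  refine (aecover_Ioc_one_div.integral_tendsto_of_countably_generated hf).congr fun n => ?_
  rw [intervalIntegral.integral_of_le (one_div_add_one_le n), restrict_Ioi_restrict_Ioc]

/-- A function that is nonnegative and has bounded integrals over compact subintervals of
`(0, ∞)` is integrable. -/
theorem integrableOn_Ioi_of_bounded {f : ℝ → ℝ} {C : ℝ} (hf0 : ∀ r, 0 < r → 0 ≤ f r)
    (hf : ∀ a b, 0 < a → a ≤ b → IntervalIntegrable f volume a b)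
    (hC : ∀ a b, 0 < a → a ≤ b → ∫ r in a..b, f r ≤ C) :
    IntegrableOn f (Ioi 0) ∧ ∫ r in Ioi 0, f r ≤ C := by
  have hval : ∀ n : ℕ, ∫ r in Ioc (1 / ((n : ℝ) + 1)) ((n : ℝ) + 1), f r
      ∂(volume.restrict (Ioi (0 : ℝ))) ≤ C := fun n => by
    rw [restrict_Ioi_restrict_Ioc, ← intervalIntegral.integral_of_le (one_div_add_one_le n)]
    exact hC _ _ (by positivity) (one_div_add_one_le n)
  have hint : IntegrableOn f (Ioi 0) := by
    refine aecover_Ioc_one_div.integrable_of_integral_bounded_of_nonneg_ae C (fun n => ?_) ?_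
      (Eventually.of_forall hval)
    · rw [IntegrableOn, restrict_Ioi_restrict_Ioc]
      exact ((hf _ _ (by positivity) (one_div_add_one_le n)).1)
    · filter_upwards [ae_restrict_mem measurableSet_Ioi] with r hr using hf0 r hr
  exact ⟨hint, le_of_tendsto' (aecover_Ioc_one_div.integral_tendsto_of_countably_generated hint) hval⟩

theorem integral_le_integral_Ioi {f : ℝ → ℝ} (hf0 : ∀ r, 0 < r → 0 ≤ f r)
    (hf : IntegrableOn f (Ioi 0)) {a b : ℝ} (ha : 0 < a) (hab : a ≤ b) :
    IntervalIntegrable f volume a b ∧ ∫ r in a..b, f r ≤ ∫ r in Ioi 0, f r := by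
  have hsub : Ioc a b ⊆ Ioi 0 := fun x hx => ha.trans hx.1
  refine ⟨(intervalIntegrable_iff_integrableOn_Ioc_of_le hab).2 (hf.mono_set hsub), ?_⟩
  rw [intervalIntegral.integral_of_le hab]
  refine setIntegral_mono_set hf ?_ hsub.eventuallyLE
  filter_upwards [ae_restrict_mem measurableSet_Ioi] with r hr using hf0 r hr

theorem ContinuousOn.intervalIntegrable_of_pos {f : ℝ → ℝ} (hf : ContinuousOn f (Ioi 0)) {a b : ℝ}
    (ha : 0 < a) (hab : a ≤ b) : IntervalIntegrable f volume a b :=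
  (hf.mono (by rw [uIcc_of_le hab]; exact fun x hx => ha.trans_le hx.1)).intervalIntegrable

/-! ### The frame system and its energy identity. -/

/-- The orthonormality and orientation relations of a frame `(u, v, w)` of `ℝ³`. -/
structure IsOrientedFrame (u v w : Fin 3 → ℝ) : Prop where
  uu : u 0 ^ 2 + u 1 ^ 2 + u 2 ^ 2 = 1
  vv : v 0 ^ 2 + v 1 ^ 2 + v 2 ^ 2 = 1
  ww : w 0 ^ 2 + w 1 ^ 2 + w 2 ^ 2 = 1
  uv : u 0 * v 0 + u 1 * v 1 + u 2 * v 2 = 0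
  vw : v 0 * w 0 + v 1 * w 1 + v 2 * w 2 = 0
  row : ∀ j, u j ^ 2 + v j ^ 2 + w j ^ 2 = 1
  cross_zero : u 0 = v 1 * w 2 - v 2 * w 1
  cross_one : u 1 = v 2 * w 0 - v 0 * w 2
  cross_two : u 2 = v 0 * w 1 - v 1 * w 0
  w_zero : w 0 = u 1 * v 2 - u 2 * v 1
  w_one : w 1 = u 2 * v 0 - u 0 * v 2
  w_two : w 2 = u 0 * v 1 - u 1 * v 0

/-- The components of `∂_r u` in the frame, `ψ₁ = ψ - (v₃ + i w₃) / sinh r`. -/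
noncomputable def frameRe (ψ : ℝ → ℂ) (v : ℝ → Fin 3 → ℝ) (r : ℝ) : ℝ :=
  (ψ r).re - v r 2 / Real.sinh r

noncomputable def frameIm (ψ : ℝ → ℂ) (w : ℝ → Fin 3 → ℝ) (r : ℝ) : ℝ :=
  (ψ r).im - w r 2 / Real.sinh r

/-- The system satisfied by the profile of a map and its normalized Coulomb frame. -/
structure FrameODE (ψ : ℝ → ℂ) (u v w : ℝ → Fin 3 → ℝ) : Prop where
  ac_u : ∀ j, ACOnPos fun r => u r j
  ac_v : ∀ j, ACOnPos fun r => v r j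
  ac_w : ∀ j, ACOnPos fun r => w r j
  deriv_u : ∀ᵐ r ∂(volume.restrict (Ioi (0 : ℝ))), ∀ j,
    HasDerivAt (fun r => u r j) (frameRe ψ v r * v r j + frameIm ψ w r * w r j) r
  deriv_v : ∀ᵐ r ∂(volume.restrict (Ioi (0 : ℝ))), ∀ j,
    HasDerivAt (fun r => v r j) (-(frameRe ψ v r * u r j)) r
  deriv_w : ∀ᵐ r ∂(volume.restrict (Ioi (0 : ℝ))), ∀ j,
    HasDerivAt (fun r => w r j) (-(frameIm ψ w r * u r j)) r
  frame : ∀ r, 0 < r → IsOrientedFrame (u r) (v r) (w r)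
  tendsto_u : Tendsto u atTop (𝓝 ![0, 0, 1])
  tendsto_v : Tendsto v atTop (𝓝 ![1, 0, 0])
  tendsto_w : Tendsto w atTop (𝓝 ![0, 1, 0])

/-- The energy density `|du|² sinh r` in terms of the frame. -/
noncomputable def frameEnergy (ψ : ℝ → ℂ) (v w : ℝ → Fin 3 → ℝ) (r : ℝ) : ℝ :=
  Real.sinh r * (frameRe ψ v r ^ 2 + frameIm ψ w r ^ 2) + (v r 2 ^ 2 + w r 2 ^ 2) / Real.sinh r

noncomputable def weightedSq (ψ : ℝ → ℂ) (r : ℝ) : ℝ := ‖ψ r‖ ^ 2 * Real.sinh r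

theorem weightedSq_nonneg (ψ : ℝ → ℂ) {r : ℝ} (hr : 0 < r) : 0 ≤ weightedSq ψ r :=
  mul_nonneg (sq_nonneg _) (Real.sinh_pos_iff.2 hr).le

theorem weightedSq_eq (ψ : ℝ → ℂ) (r : ℝ) :
    weightedSq ψ r = ((ψ r).re ^ 2 + (ψ r).im ^ 2) * Real.sinh r := by
  rw [weightedSq, ← Complex.normSq_eq_norm_sq, Complex.normSq_apply]
  ring

theorem frameEnergy_nonneg (ψ : ℝ → ℂ) (v w : ℝ → Fin 3 → ℝ) {r : ℝ} (hr : 0 < r) :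
    0 ≤ frameEnergy ψ v w r := by
  have := Real.sinh_pos_iff.2 hr
  unfold frameEnergy
  positivity

/-- This is `|a|² + |b|² = |a + b|² - 2 a ⬝ b`, with `a` the components of `∂_r u` and `b = (v₃ + i
w₃) / sinh r`. Along a solution the subtracted term is `2 u₃'`, a total derivative. -/
theorem frameEnergy_eq (ψ : ℝ → ℂ) (v w : ℝ → Fin 3 → ℝ) {r : ℝ} (hr : 0 < r) :
    frameEnergy ψ v w r = weightedSq ψ r
      - 2 * (frameRe ψ v r * v r 2 + frameIm ψ w r * w r 2) := by
  have := (Real.sinh_pos_iff.2 hr).ne'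
  rw [weightedSq_eq, frameEnergy, frameRe, frameIm]
  field_simp
  ring

/-- The difference is `|a - b|² sinh r`. Integrated, this limits how far `u₃` can fall below its
value at infinity. -/
theorem four_mul_le_weightedSq (ψ : ℝ → ℂ) (v w : ℝ → Fin 3 → ℝ) {r : ℝ} (hr : 0 < r) :
    4 * (frameRe ψ v r * v r 2 + frameIm ψ w r * w r 2) ≤ weightedSq ψ r := by
  have hs := Real.sinh_pos_iff.2 hr
  have h : weightedSq ψ r - 4 * (frameRe ψ v r * v r 2 + frameIm ψ w r * w r 2)
      = Real.sinh r * ((frameRe ψ v r - v r 2 / Real.sinh r) ^ 2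
        + (frameIm ψ w r - w r 2 / Real.sinh r) ^ 2) := by
    rw [weightedSq_eq, frameRe, frameIm]
    field_simp
    ring
  have : 0 ≤ Real.sinh r * ((frameRe ψ v r - v r 2 / Real.sinh r) ^ 2
        + (frameIm ψ w r - w r 2 / Real.sinh r) ^ 2) := by positivity
  linarith

theorem two_mul_abs_le_frameEnergy (ψ : ℝ → ℂ) (v w : ℝ → Fin 3 → ℝ) {r : ℝ} (hr : 0 < r) :
    |frameRe ψ v r * v r 2 + frameIm ψ w r * w r 2| ≤ frameEnergy ψ v w r := by
  have hs := Real.sinh_pos_iff.2 hr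
  -- Completing the square with a free sign: at `ε = ±1` the last term vanishes and a nonnegative
  -- expression remains.
  have h := fun ε : ℝ => show frameEnergy ψ v w r
      + 2 * ε * (frameRe ψ v r * v r 2 + frameIm ψ w r * w r 2)
      = Real.sinh r * ((frameRe ψ v r + ε * (v r 2 / Real.sinh r)) ^ 2
        + (frameIm ψ w r + ε * (w r 2 / Real.sinh r)) ^ 2)
        + (1 - ε ^ 2) * ((v r 2 ^ 2 + w r 2 ^ 2) / Real.sinh r) by
    rw [frameEnergy]
    field_simp
    ring
  have h0 := frameEnergy_nonneg ψ v w hr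
  have h1 := h 1
  have h2 := h (-1)
  have p1 : 0 ≤ Real.sinh r * ((frameRe ψ v r + 1 * (v r 2 / Real.sinh r)) ^ 2
        + (frameIm ψ w r + 1 * (w r 2 / Real.sinh r)) ^ 2) := by positivity
  have p2 : 0 ≤ Real.sinh r * ((frameRe ψ v r + (-1) * (v r 2 / Real.sinh r)) ^ 2
        + (frameIm ψ w r + (-1) * (w r 2 / Real.sinh r)) ^ 2) := by positivity
  rw [abs_le]
  constructor <;> linarith

namespace FrameODE

variable {ψ : ℝ → ℂ} {u v w : ℝ → Fin 3 → ℝ}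

theorem integral_deriv (h : FrameODE ψ u v w) {a b : ℝ} (ha : 0 < a) (hab : a ≤ b) :
    IntervalIntegrable (fun r => frameRe ψ v r * v r 2 + frameIm ψ w r * w r 2) volume a b ∧
      ∫ r in a..b, (frameRe ψ v r * v r 2 + frameIm ψ w r * w r 2) = u b 2 - u a 2 :=
  (h.ac_u 2).integral_eq_sub (by filter_upwards [h.deriv_u] with r hr using hr 2) ha hab

theorem integral_frameEnergy (h : FrameODE ψ u v w) (hψ : IntegrableOn (weightedSq ψ) (Ioi 0))
    {a b : ℝ} (ha : 0 < a) (hab : a ≤ b) :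
    IntervalIntegrable (frameEnergy ψ v w) volume a b ∧
      ∫ r in a..b, frameEnergy ψ v w r
        = (∫ r in a..b, weightedSq ψ r) - 2 * (u b 2 - u a 2) := by
  obtain ⟨h1, h2⟩ := h.integral_deriv ha hab
  have h3 := (integral_le_integral_Ioi (fun r => weightedSq_nonneg ψ) hψ ha hab).1
  have heq : ∀ r ∈ uIoc a b, weightedSq ψ r
      - 2 * (frameRe ψ v r * v r 2 + frameIm ψ w r * w r 2) = frameEnergy ψ v w r := by
    intro r hr
    rw [uIoc_of_le hab] at hr
    exact (frameEnergy_eq ψ v w (ha.trans hr.1)).symm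
  refine ⟨(h3.sub (h1.const_mul 2)).congr heq, ?_⟩
  rw [← h2, ← intervalIntegral.integral_const_mul, ← intervalIntegral.integral_sub h3
    (h1.const_mul 2)]
  exact intervalIntegral.integral_congr_ae (Eventually.of_forall fun r hr => (heq r hr).symm)

theorem tendsto_u_two (h : FrameODE ψ u v w) : Tendsto (fun r => u r 2) atTop (𝓝 1) :=
  (tendsto_pi_nhds.1 h.tendsto_u 2)

/-- Integrate `4 u₃' ≤ |ψ|² sinh r` over `[a, b]` and let `b → ∞`, where `u₃ → 1`. -/
theorem one_sub_le (h : FrameODE ψ u v w) (hψ : IntegrableOn (weightedSq ψ) (Ioi 0))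
    {a : ℝ} (ha : 0 < a) : 1 - (∫ r in Ioi 0, weightedSq ψ r) / 4 ≤ u a 2 := by
  have hb : ∀ᶠ b in atTop, u b 2 - (∫ r in Ioi 0, weightedSq ψ r) / 4 ≤ u a 2 := by
    filter_upwards [eventually_ge_atTop a] with b hab
    obtain ⟨h1, h2⟩ := h.integral_deriv ha hab
    obtain ⟨h3, h4⟩ := integral_le_integral_Ioi (fun r => weightedSq_nonneg ψ) hψ ha hab
    have := intervalIntegral.integral_mono_on hab (h1.const_mul 4) h3
      fun r hr => four_mul_le_weightedSq ψ v w (ha.trans_le hr.1)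
    rw [intervalIntegral.integral_const_mul, h2] at this
    linarith
  exact le_of_tendsto (h.tendsto_u_two.sub_const _) hb

theorem u_two_pos (h : FrameODE ψ u v w) (hψ : IntegrableOn (weightedSq ψ) (Ioi 0))
    (hM : ∫ r in Ioi 0, weightedSq ψ r < 4) {a : ℝ} (ha : 0 < a) : 0 < u a 2 := by
  have := h.one_sub_le hψ ha
  linarith

theorem u_two_le_one (h : FrameODE ψ u v w) {a : ℝ} (ha : 0 < a) : u a 2 ≤ 1 := by
  have := (h.frame a ha).uu
  nlinarith [sq_nonneg (u a 0), sq_nonneg (u a 1)]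

/-- The bound `6` is `4 + 2`: at most `4` from `ψ`, and at most `2` from `-2 (u₃(b) - u₃(a))`
because `0 < u₃ ≤ 1`. It is independent of `ψ`, which makes the later Lipschitz constant absolute.
-/
theorem integrable_frameEnergy (h : FrameODE ψ u v w) (hψ : IntegrableOn (weightedSq ψ) (Ioi 0))
    (hM : ∫ r in Ioi 0, weightedSq ψ r < 4) :
    IntegrableOn (frameEnergy ψ v w) (Ioi 0) ∧ ∫ r in Ioi 0, frameEnergy ψ v w r ≤ 6 := by
  refine integrableOn_Ioi_of_bounded (fun r => frameEnergy_nonneg ψ v w)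
    (fun a b ha hab => (h.integral_frameEnergy hψ ha hab).1) fun a b ha hab => ?_
  rw [(h.integral_frameEnergy hψ ha hab).2]
  have h1 := (integral_le_integral_Ioi (fun r => weightedSq_nonneg ψ) hψ ha hab).2
  have h2 := h.u_two_pos hψ hM (ha.trans_le hab)
  have h3 := h.u_two_le_one ha
  linarith

end FrameODE

/-! ### Behaviour at the origin and the energy equality. -/

/-- By the mean value inequality `sinh r ≤ r cosh δ` on `(0, δ]`, so integrability would pass to `1
/ r`. -/
theorem not_integrableOn_inv_sinh {δ : ℝ} (hδ : 0 < δ) :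
    ¬ IntegrableOn (fun r => (Real.sinh r)⁻¹) (Ioc 0 δ) := by
  intro hint
  have hc := Real.cosh_pos δ
  have h1 : IntegrableOn (fun r : ℝ => r⁻¹) (Ioc 0 δ) := by
    refine Integrable.mono' (hint.const_mul (Real.cosh δ)) measurable_inv.aestronglyMeasurable ?_
    filter_upwards [ae_restrict_mem measurableSet_Ioc] with r hr
    have hs := Real.sinh_pos_iff.2 hr.1
    rw [Real.norm_of_nonneg (inv_nonneg.2 hr.1.le), ← div_eq_mul_inv, inv_eq_one_div,
      div_le_div_iff₀ hr.1 hs, one_mul]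
    have hmvt := (convex_Icc 0 δ).norm_image_sub_le_of_norm_deriv_le (f := Real.sinh)
      (C := Real.cosh δ) (fun x _ => Real.differentiable_sinh x) (fun x hx => by
        rw [Real.deriv_sinh, Real.norm_of_nonneg (Real.cosh_pos x).le, Real.cosh_le_cosh,
          abs_of_nonneg hx.1, abs_of_nonneg hδ.le]
        exact hx.2) (left_mem_Icc.2 hδ.le) (Ioc_subset_Icc_self hr)
    rwa [Real.sinh_zero, sub_zero, sub_zero, Real.norm_of_nonneg hs.le,
      Real.norm_of_nonneg hr.1.le] at hmvt
  have h2 := (intervalIntegrable_iff_integrableOn_Ioc_of_le hδ.le).2 h1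
  rw [intervalIntegrable_inv_iff] at h2
  rcases h2 with h2 | h2
  · exact hδ.ne h2
  · exact h2 left_mem_uIcc

namespace FrameODE

variable {ψ : ℝ → ℂ} {u v w : ℝ → Fin 3 → ℝ}

/-- The derivative of `u₃` is dominated by the energy density, so `u₃` has a limit `L` in `[0, 1]`
at the origin. If `L < 1`, then `v₃² + w₃² = 1 - u₃²` stays away from `0`, and finite energy would
make `1 / sinh r` integrable. -/
theorem tendsto_u_zero (h : FrameODE ψ u v w) (hψ : IntegrableOn (weightedSq ψ) (Ioi 0))
    (hM : ∫ r in Ioi 0, weightedSq ψ r < 4) :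
    Tendsto (fun r => u r 2) (𝓝[>] 0) (𝓝 1) := by
  have hE := (h.integrable_frameEnergy hψ hM).1
  set g : ℝ → ℝ := fun r => frameRe ψ v r * v r 2 + frameIm ψ w r * w r 2 with hg
  have hdu : ∀ᵐ r ∂(volume.restrict (Ioi (0 : ℝ))), HasDerivAt (fun r => u r 2) (g r) r := by
    filter_upwards [h.deriv_u] with r hr using hr 2
  have hgm : AEStronglyMeasurable g (volume.restrict (Ioi 0)) := by
    refine AEStronglyMeasurable.congr
      (measurable_deriv (fun r => u r 2)).aestronglyMeasurable ?_
    filter_upwards [hdu] with r hr using hr.deriv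
  have hgi : IntegrableOn g (Ioi 0) := by
    refine Integrable.mono' hE hgm ?_
    filter_upwards [ae_restrict_mem measurableSet_Ioi] with r hr
    exact two_mul_abs_le_frameEnergy ψ v w hr
  have hg1 : IntervalIntegrable g volume 0 1 :=
    (intervalIntegrable_iff_integrableOn_Ioc_of_le zero_le_one).2
      (hgi.mono_set Ioc_subset_Ioi_self)
  have hcont : ContinuousOn (fun x => ∫ r in x..1, g r) (uIcc 0 1) :=
    intervalIntegral.continuousOn_primitive_interval_left
      (by rw [uIcc_of_le zero_le_one, integrableOn_Icc_iff_integrableOn_Ioc]; exact hg1.1)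
  have hlim : Tendsto (fun r => u r 2) (𝓝[>] 0) (𝓝 (u 1 2 - ∫ r in (0 : ℝ)..1, g r)) := by
    have h1 : Tendsto (fun x => ∫ r in x..1, g r) (𝓝[>] 0) (𝓝 (∫ r in (0 : ℝ)..1, g r)) := by
      have := hcont 0 left_mem_uIcc
      rw [uIcc_of_le zero_le_one] at this
      refine this.mono_left ?_
      rw [← nhdsWithin_Ioc_eq_nhdsGT (zero_lt_one' ℝ)]
      exact nhdsWithin_mono _ Ioc_subset_Icc_self
    refine (tendsto_const_nhds.sub h1).congr' ?_
    filter_upwards [Ioc_mem_nhdsGT (zero_lt_one' ℝ)] with x hx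
    rw [(h.integral_deriv hx.1 hx.2).2]
    ring
  set L := u 1 2 - ∫ r in (0 : ℝ)..1, g r with hL
  have hL1 : L ≤ 1 := le_of_tendsto hlim (by
    filter_upwards [self_mem_nhdsWithin] with r hr using h.u_two_le_one hr)
  have hL0 : 0 ≤ L := ge_of_tendsto hlim (by
    filter_upwards [self_mem_nhdsWithin] with r hr using (h.u_two_pos hψ hM hr).le)
  rcases hL1.lt_or_eq with hlt | heq
  · exfalso
    have hev : ∀ᶠ r in 𝓝[>] (0 : ℝ), u r 2 < (1 + L) / 2 :=
      hlim.eventually_lt_const (by linarith)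
    obtain ⟨δ, hδ, hsub⟩ := mem_nhdsGT_iff_exists_Ioc_subset.1 hev
    have hδ : 0 < δ := hδ
    refine not_integrableOn_inv_sinh hδ ?_
    have hdom : IntegrableOn (fun r => ((1 - L) / 2)⁻¹ * frameEnergy ψ v w r) (Ioc 0 δ) :=
      (hE.mono_set Ioc_subset_Ioi_self).const_mul _
    refine Integrable.mono' hdom
      (Real.measurable_sinh.inv).aestronglyMeasurable ?_
    filter_upwards [ae_restrict_mem measurableSet_Ioc] with r hr
    have hs := Real.sinh_pos_iff.2 hr.1
    have hu : u r 2 < (1 + L) / 2 := hsub hr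
    have hu0 := h.u_two_pos hψ hM hr.1
    have hrow := (h.frame r hr.1).row 2
    rw [Real.norm_of_nonneg (inv_nonneg.2 hs.le)]
    -- Positivity gives `u₃² < u₃` when `u₃ < 1`, hence `1 - u₃² > 1 - u₃ > (1 - L) / 2`.
    have h1 : (1 - L) / 2 ≤ v r 2 ^ 2 + w r 2 ^ 2 := by nlinarith
    have h2 : (1 - L) / 2 * (Real.sinh r)⁻¹ ≤ frameEnergy ψ v w r := by
      have : (v r 2 ^ 2 + w r 2 ^ 2) / Real.sinh r ≤ frameEnergy ψ v w r := by
        have : 0 ≤ Real.sinh r * (frameRe ψ v r ^ 2 + frameIm ψ w r ^ 2) := by positivity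
        unfold frameEnergy
        linarith
      refine le_trans ?_ this
      rw [div_eq_mul_inv (v r 2 ^ 2 + w r 2 ^ 2)]
      gcongr
    rw [inv_mul_eq_div, le_div_iff₀ (by linarith), mul_comm]
    exact h2
  · rwa [heq] at hlim

/-- The boundary contribution vanishes because `u₃` has the same limit at `0` and at `∞`. -/
theorem integral_frameEnergy_eq (h : FrameODE ψ u v w)
    (hψ : IntegrableOn (weightedSq ψ) (Ioi 0)) (hM : ∫ r in Ioi 0, weightedSq ψ r < 4) :
    ∫ r in Ioi 0, frameEnergy ψ v w r = ∫ r in Ioi 0, weightedSq ψ r := by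
  have hE := (h.integrable_frameEnergy hψ hM).1
  have h0 := h.tendsto_u_zero hψ hM
  have hb : Tendsto (fun n : ℕ => (n : ℝ) + 1) atTop atTop :=
    tendsto_atTop_add_const_right _ _ tendsto_natCast_atTop_atTop
  have ha : Tendsto (fun n : ℕ => 1 / ((n : ℝ) + 1)) atTop (𝓝[>] 0) :=
    tendsto_nhdsWithin_iff.2 ⟨tendsto_one_div_add_atTop_nhds_zero_nat,
      Eventually.of_forall fun n => show (0 : ℝ) < 1 / ((n : ℝ) + 1) by positivity⟩
  have hlim := (tendsto_intervalIntegral_Ioi hψ).sub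
    (((h.tendsto_u_two.comp hb).sub (h0.comp ha)).const_mul 2)
  refine tendsto_nhds_unique ((tendsto_intervalIntegral_Ioi hE).congr fun n => ?_) (by rwa [sub_self, mul_zero, sub_zero] at hlim)
  exact (h.integral_frameEnergy hψ (by positivity) (one_div_add_one_le n)).2

end FrameODE

/-! ### Stability estimates for two solutions of the frame system. -/

/-- The squared difference of the `j`-th coordinates of two frames. -/
def frameDiffSq (u v w u' v' w' : ℝ → Fin 3 → ℝ) (j : Fin 3) (r : ℝ) : ℝ :=
  (u r j - u' r j) ^ 2 + (v r j - v' r j) ^ 2 + (w r j - w' r j) ^ 2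

theorem frameDiffSq_nonneg (u v w u' v' w' : ℝ → Fin 3 → ℝ) (j : Fin 3) (r : ℝ) :
    0 ≤ frameDiffSq u v w u' v' w' j r := by
  unfold frameDiffSq
  positivity

/-- The radial part of `|d(u - u')|² sinh r`. -/
noncomputable def frameDistDensity (ψ ψ' : ℝ → ℂ) (u v w u' v' w' : ℝ → Fin 3 → ℝ) (r : ℝ) : ℝ :=
  Real.sinh r * ∑ j, (frameRe ψ v r * v r j + frameIm ψ w r * w r j
      - (frameRe ψ' v' r * v' r j + frameIm ψ' w' r * w' r j)) ^ 2
    + ((u r 0 - u' r 0) ^ 2 + (u r 1 - u' r 1) ^ 2) / Real.sinh r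

section Algebra

theorem sphere_diff_identity {u v w u' v' w' : ℝ} (h : u ^ 2 + v ^ 2 + w ^ 2 = 1)
    (h' : u' ^ 2 + v' ^ 2 + w' ^ 2 = 1) :
    u * ((v - v') ^ 2 + (w - w') ^ 2) - (u - u') * ((v - v') * v + (w - w') * w)
      = ((u - u') ^ 2 + (v - v') ^ 2 + (w - w') ^ 2) * ((u + u') / 2) := by
  linear_combination (-(u - u') / 2) * h + ((u - u') / 2) * h'

/-- Here `s = sinh r`, `p + iq = ψ`, and `(u, v, w)` are the vertical components. The singular part
of the derivative is exactly `t ρ (u + u')`, which is nearly `2tρ` when both points are near the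
pole; half of this pays for the cross terms with `ψ - ψ'`, and the deficit from the pole becomes the
Grönwall weight. -/
theorem vertical_diff_deriv_ge {s t p q p' q' u v w u' v' w' : ℝ} (hs : 0 < s) (hst : s * t = 1)
    (h : u ^ 2 + v ^ 2 + w ^ 2 = 1) (h' : u' ^ 2 + v' ^ 2 + w' ^ 2 = 1)
    (hu : 0 ≤ u) (hu' : 0 ≤ u') :
    t * ((u - u') ^ 2 + (v - v') ^ 2 + (w - w') ^ 2)
      - ((v ^ 2 + w ^ 2) * t + (v' ^ 2 + w' ^ 2) * t)
        * ((u - u') ^ 2 + (v - v') ^ 2 + (w - w') ^ 2)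
      - ((p - p') ^ 2 + (q - q') ^ 2) * s
    ≤ 2 * ((u - u') * ((p - v * t) * v + (q - w * t) * w
          - ((p' - v' * t) * v' + (q' - w' * t) * w'))
        - (v - v') * ((p - v * t) * u - (p' - v' * t) * u')
        - (w - w') * ((q - w * t) * u - (q' - w' * t) * u')) := by
  have ht : 0 < t := pos_of_mul_pos_right (hst ▸ one_pos) hs.le
  set ρ := (u - u') ^ 2 + (v - v') ^ 2 + (w - w') ^ 2 with hρ
  have hρ0 : 0 ≤ ρ := by positivity
  have e1 : 2 * ((u - u') * ((p - v * t) * v + (q - w * t) * w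
          - ((p' - v' * t) * v' + (q' - w' * t) * w'))
        - (v - v') * ((p - v * t) * u - (p' - v' * t) * u')
        - (w - w') * ((q - w * t) * u - (q' - w' * t) * u'))
      = t * ρ * (u + u') + 2 * ((p - p') * ((u - u') * v - u * (v - v'))
        + (q - q') * ((u - u') * w - u * (w - w'))) := by
    linear_combination 2 * t * sphere_diff_identity h h'
  -- Lagrange's identity for the difference vector and the unit vector `(u, v, w)`: squared cross
  -- product plus squared inner product.
  have e2 : ρ = ((u - u') * v - u * (v - v')) ^ 2 + ((u - u') * w - u * (w - w')) ^ 2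
      + ((v - v') * w - (w - w') * v) ^ 2
      + ((u - u') * u + (v - v') * v + (w - w') * w) ^ 2 := by
    rw [hρ]
    linear_combination (-((u - u') ^ 2 + (v - v') ^ 2 + (w - w') ^ 2)) * h
  have amgm : ∀ x y : ℝ, -(x ^ 2 * s) - t * y ^ 2 ≤ 2 * (x * y) := fun x y => by
    have : 0 ≤ t * (s * x + y) ^ 2 := by positivity
    have e : t * (s * x + y) ^ 2 = x ^ 2 * s + 2 * (x * y) + t * y ^ 2 := by
      linear_combination (x ^ 2 * s + 2 * x * y) * hst
    linarith
  have a1 := amgm (p - p') ((u - u') * v - u * (v - v'))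
  have a2 := amgm (q - q') ((u - u') * w - u * (w - w'))
  have a3 : t * (((u - u') * v - u * (v - v')) ^ 2 + ((u - u') * w - u * (w - w')) ^ 2)
      ≤ t * ρ := by
    gcongr
    rw [e2]
    linarith [sq_nonneg ((v - v') * w - (w - w') * v),
      sq_nonneg ((u - u') * u + (v - v') * v + (w - w') * w)]
  have hu1 : u ≤ 1 := (sq_le_one_iff₀ hu).1 (by linarith [sq_nonneg v, sq_nonneg w])
  have hu1' : u' ≤ 1 := (sq_le_one_iff₀ hu').1 (by linarith [sq_nonneg v', sq_nonneg w'])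
  -- For `0 ≤ u ≤ 1` one has `u ≥ u² = 1 - v² - w²`; this is where the sign of the vertical
  -- component is indispensable.
  have b1 : 2 - (v ^ 2 + w ^ 2) - (v' ^ 2 + w' ^ 2) ≤ u + u' := by
    have c1 := mul_nonneg hu (sub_nonneg.2 hu1)
    have c2 := mul_nonneg hu' (sub_nonneg.2 hu1')
    linarith
  have b2 := mul_le_mul_of_nonneg_left b1 (mul_nonneg ht.le hρ0)
  rw [e1]
  linarith

/-- Since `u = v × w`, every monomial of `u₀` and `u₁` has a factor `v₃` or `w₃`. Each term of the
difference therefore contains either a difference of vertical components or the small factor `v₃'`,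
`w₃'`, whose square over `sinh r` is integrable. -/
theorem IsOrientedFrame.horizontal_diff_le {u v w u' v' w' : Fin 3 → ℝ}
    (h : IsOrientedFrame u v w) (h' : IsOrientedFrame u' v' w') :
    (u 0 - u' 0) ^ 2 + (u 1 - u' 1) ^ 2
      ≤ 8 * ((u 2 - u' 2) ^ 2 + (v 2 - v' 2) ^ 2 + (w 2 - w' 2) ^ 2)
        + 8 * (v' 2 ^ 2 + w' 2 ^ 2)
          * (((u 0 - u' 0) ^ 2 + (v 0 - v' 0) ^ 2 + (w 0 - w' 0) ^ 2)
            + ((u 1 - u' 1) ^ 2 + (v 1 - v' 1) ^ 2 + (w 1 - w' 1) ^ 2)) := by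
  have four : ∀ a b c d : ℝ, (a + b - c - d) ^ 2 ≤ 4 * (a ^ 2 + b ^ 2 + c ^ 2 + d ^ 2) :=
    fun a b c d => by
      nlinarith [sq_nonneg (a - b), sq_nonneg (a + c), sq_nonneg (a + d), sq_nonneg (b + c),
        sq_nonneg (b + d), sq_nonneg (c - d)]
  have e0 : u 0 - u' 0 = v 1 * (w 2 - w' 2) + (v 1 - v' 1) * w' 2 - w 1 * (v 2 - v' 2)
      - (w 1 - w' 1) * v' 2 := by
    rw [h.cross_zero, h'.cross_zero]; ring
  have e1 : u 1 - u' 1 = w 0 * (v 2 - v' 2) + (w 0 - w' 0) * v' 2 - v 0 * (w 2 - w' 2)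
      - (v 0 - v' 0) * w' 2 := by
    rw [h.cross_one, h'.cross_one]; ring
  have f0 := four (v 1 * (w 2 - w' 2)) ((v 1 - v' 1) * w' 2) (w 1 * (v 2 - v' 2))
    ((w 1 - w' 1) * v' 2)
  have f1 := four (w 0 * (v 2 - v' 2)) ((w 0 - w' 0) * v' 2) (v 0 * (w 2 - w' 2))
    ((v 0 - v' 0) * w' 2)
  rw [← e0] at f0
  rw [← e1] at f1
  have hv : ∀ j, v j ^ 2 ≤ 1 := fun j => by nlinarith [h.row j, sq_nonneg (u j), sq_nonneg (w j)]
  have hw : ∀ j, w j ^ 2 ≤ 1 := fun j => by nlinarith [h.row j, sq_nonneg (u j), sq_nonneg (v j)]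
  have g : ∀ x y : ℝ, x ^ 2 ≤ 1 → (x * y) ^ 2 ≤ y ^ 2 := fun x y hx => by
    rw [mul_pow]; nlinarith [sq_nonneg y]
  have g1 := g _ (w 2 - w' 2) (hv 1)
  have g2 := g _ (v 2 - v' 2) (hw 1)
  have g3 := g _ (v 2 - v' 2) (hw 0)
  have g4 := g _ (w 2 - w' 2) (hv 0)
  have m : ∀ x y : ℝ, 0 ≤ x ^ 2 * y ^ 2 := fun x y => by positivity
  simp only [mul_pow] at f0 f1 g1 g2 g3 g4
  nlinarith [m (v' 2) (u 0 - u' 0), m (v' 2) (u 1 - u' 1), m (v' 2) (v 0 - v' 0),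
    m (v' 2) (v 1 - v' 1), m (v' 2) (w 0 - w' 0), m (v' 2) (w 1 - w' 1),
    m (w' 2) (u 0 - u' 0), m (w' 2) (u 1 - u' 1), m (w' 2) (v 0 - v' 0),
    m (w' 2) (v 1 - v' 1), m (w' 2) (w 0 - w' 0), m (w' 2) (w 1 - w' 1),
    sq_nonneg (u 2 - u' 2)]

/-- The generators of the frame motion are skew, so a common generator preserves the distance of two
solutions: only the differences `A`, `B` of the coefficients survive, and the rest is the
arithmetic-geometric mean inequality with weights `s` and `t = 1 / s`. -/
theorem diff_deriv_ge {s t A B α β α' β' u v w u' v' w' : ℝ} (hs : 0 < s) (hst : s * t = 1)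
    (hA : A = α - α') (hB : B = β - β') (hvw : v ^ 2 + w ^ 2 ≤ 1) :
    -(t * (u - u') ^ 2) - 2 * (s * (A ^ 2 + B ^ 2))
      - t * (u ^ 2 * ((v - v') ^ 2 + (w - w') ^ 2))
    ≤ 2 * ((u - u') * (α * v + β * w - (α' * v' + β' * w'))
        - (v - v') * (α * u - α' * u') - (w - w') * (β * u - β' * u')) := by
  have ht : 0 < t := pos_of_mul_pos_right (hst ▸ one_pos) hs.le
  have e : 2 * ((u - u') * (α * v + β * w - (α' * v' + β' * w'))
        - (v - v') * (α * u - α' * u') - (w - w') * (β * u - β' * u'))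
      = 2 * ((A * v + B * w) * (u - u')) + 2 * (A * -(u * (v - v')))
        + 2 * (B * -(u * (w - w'))) := by
    rw [hA, hB]; ring
  have amgm : ∀ x y : ℝ, -(x ^ 2 * s) - t * y ^ 2 ≤ 2 * (x * y) := fun x y => by
    have : 0 ≤ t * (s * x + y) ^ 2 := by positivity
    have e : t * (s * x + y) ^ 2 = x ^ 2 * s + 2 * (x * y) + t * y ^ 2 := by
      linear_combination (x ^ 2 * s + 2 * x * y) * hst
    linarith
  have a1 := amgm (A * v + B * w) (u - u')
  have a2 := amgm A (-(u * (v - v')))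
  have a3 := amgm B (-(u * (w - w')))
  have c1 : (A * v + B * w) ^ 2 ≤ A ^ 2 + B ^ 2 := by
    have : 0 ≤ (A ^ 2 + B ^ 2) * (1 - (v ^ 2 + w ^ 2)) :=
      mul_nonneg (by positivity) (by linarith)
    nlinarith [sq_nonneg (A * w - B * v)]
  have c2 := mul_le_mul_of_nonneg_right c1 hs.le
  rw [e]
  linarith

/-- Applied with vertical components, this bounds the difference of the coefficients of `∂_r u` by
quantities that the vertical estimate controls. -/
theorem weighted_sq_sub_le {s t p q p' q' v w v' w' : ℝ} (hs : 0 < s) (hst : s * t = 1) :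
    s * ((p - v * t - (p' - v' * t)) ^ 2 + (q - w * t - (q' - w' * t)) ^ 2)
      ≤ 2 * (((p - p') ^ 2 + (q - q') ^ 2) * s) + 2 * (t * ((v - v') ^ 2 + (w - w') ^ 2)) := by
  have e : ∀ x y : ℝ, s * (x - y * t) ^ 2 ≤ 2 * (x ^ 2 * s) + 2 * (t * y ^ 2) := fun x y => by
    have h0 : 0 ≤ s * (x + y * t) ^ 2 := by positivity
    have h1 : s * (x - y * t) ^ 2 + s * (x + y * t) ^ 2 = 2 * (x ^ 2 * s) + 2 * (t * y ^ 2) := by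
      linear_combination 2 * y ^ 2 * t * hst
    linarith
  have e1 := e (p - p') (v - v')
  have e2 := e (q - q') (w - w')
  have f1 : p - v * t - (p' - v' * t) = p - p' - (v - v') * t := by ring
  have f2 : q - w * t - (q' - w' * t) = q - q' - (w - w') * t := by ring
  rw [f1, f2]
  linarith

end Algebra

/-- The derivative of `frameDiffSq` along two solutions of the frame system. -/
noncomputable def frameDiffSqDeriv (ψ ψ' : ℝ → ℂ) (u v w u' v' w' : ℝ → Fin 3 → ℝ) (j : Fin 3)
    (r : ℝ) : ℝ :=
  2 * ((u r j - u' r j) * (frameRe ψ v r * v r j + frameIm ψ w r * w r j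
        - (frameRe ψ' v' r * v' r j + frameIm ψ' w' r * w' r j))
    - (v r j - v' r j) * (frameRe ψ v r * u r j - frameRe ψ' v' r * u' r j)
    - (w r j - w' r j) * (frameIm ψ w r * u r j - frameIm ψ' w' r * u' r j))

theorem vertical_div_sinh_le (ψ : ℝ → ℂ) (v w : ℝ → Fin 3 → ℝ) {r : ℝ} (hr : 0 < r) :
    (v r 2 ^ 2 + w r 2 ^ 2) / Real.sinh r ≤ frameEnergy ψ v w r := by
  have hs := Real.sinh_pos_iff.2 hr
  have : 0 ≤ Real.sinh r * (frameRe ψ v r ^ 2 + frameIm ψ w r ^ 2) := by positivity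
  unfold frameEnergy
  linarith

theorem ContinuousOn.div_sinh {f : ℝ → ℝ} (hf : ContinuousOn f (Ioi 0)) :
    ContinuousOn (fun r => f r / Real.sinh r) (Ioi 0) :=
  hf.div Real.continuous_sinh.continuousOn fun _ hr => (Real.sinh_pos_iff.2 hr).ne'

namespace FrameODE

variable {ψ ψ' : ℝ → ℂ} {u v w u' v' w' : ℝ → Fin 3 → ℝ}

theorem integral_vertical_le (h : FrameODE ψ u v w) (hψ : IntegrableOn (weightedSq ψ) (Ioi 0))
    (hM : ∫ r in Ioi 0, weightedSq ψ r < 4) {a b : ℝ} (ha : 0 < a) (hab : a ≤ b) :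
    IntervalIntegrable (fun r => (v r 2 ^ 2 + w r 2 ^ 2) / Real.sinh r) volume a b ∧
      ∫ r in a..b, (v r 2 ^ 2 + w r 2 ^ 2) / Real.sinh r ≤ 6 := by
  have hc : ContinuousOn (fun r => (v r 2 ^ 2 + w r 2 ^ 2) / Real.sinh r) (Ioi 0) :=
    ContinuousOn.div_sinh ((h.ac_v 2).sq.add (h.ac_w 2).sq).continuousOn
  have hi := hc.intervalIntegrable_of_pos ha hab
  refine ⟨hi, ?_⟩
  obtain ⟨h1, h2⟩ := h.integrable_frameEnergy hψ hM
  obtain ⟨h3, h4⟩ := integral_le_integral_Ioi (fun r => frameEnergy_nonneg ψ v w) h1 ha hab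
  have h5 := intervalIntegral.integral_mono_on hab hi h3
    fun r hr => vertical_div_sinh_le ψ v w (ha.trans_le hr.1)
  linarith

theorem ac_frameDiffSq (h : FrameODE ψ u v w) (h' : FrameODE ψ' u' v' w') (j : Fin 3) :
    ACOnPos (frameDiffSq u v w u' v' w' j) :=
  (((h.ac_u j).sub (h'.ac_u j)).sq.add ((h.ac_v j).sub (h'.ac_v j)).sq).add
    ((h.ac_w j).sub (h'.ac_w j)).sq

theorem hasDerivAt_frameDiffSq (h : FrameODE ψ u v w) (h' : FrameODE ψ' u' v' w') :
    ∀ᵐ r ∂(volume.restrict (Ioi (0 : ℝ))), ∀ j,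
      HasDerivAt (frameDiffSq u v w u' v' w' j) (frameDiffSqDeriv ψ ψ' u v w u' v' w' j r) r := by
  filter_upwards [h.deriv_u, h.deriv_v, h.deriv_w, h'.deriv_u, h'.deriv_v, h'.deriv_w]
    with r h1 h2 h3 h1' h2' h3' j
  have := ((((h1 j).sub (h1' j)).pow 2).add (((h2 j).sub (h2' j)).pow 2)).add
    (((h3 j).sub (h3' j)).pow 2)
  refine this.congr_deriv ?_
  simp only [frameDiffSqDeriv, Pi.sub_apply]
  ring

theorem tendsto_frameDiffSq (h : FrameODE ψ u v w) (h' : FrameODE ψ' u' v' w') (j : Fin 3) :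
    Tendsto (frameDiffSq u v w u' v' w' j) atTop (𝓝 0) := by
  have h1 := (tendsto_pi_nhds.1 h.tendsto_u j).sub (tendsto_pi_nhds.1 h'.tendsto_u j)
  have h2 := (tendsto_pi_nhds.1 h.tendsto_v j).sub (tendsto_pi_nhds.1 h'.tendsto_v j)
  have h3 := (tendsto_pi_nhds.1 h.tendsto_w j).sub (tendsto_pi_nhds.1 h'.tendsto_w j)
  have h4 := ((h1.pow 2).add (h2.pow 2)).add (h3.pow 2)
  simp only [sub_self, ne_eq, OfNat.ofNat_ne_zero, not_false_eq_true, zero_pow, add_zero] at h4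
  exact h4

/-- The vertical components form a closed system. Grönwall is run backward from infinity with
exponent `12 = 6 + 6`, one energy bound for each solution; retaining the good term also gives the
integral of `ρ / sinh r`, needed for the horizontal components. -/
theorem vertical_diff_bound (h : FrameODE ψ u v w) (h' : FrameODE ψ' u' v' w')
    (hψ : IntegrableOn (weightedSq ψ) (Ioi 0)) (hM : ∫ r in Ioi 0, weightedSq ψ r < 4)
    (hψ' : IntegrableOn (weightedSq ψ') (Ioi 0)) (hM' : ∫ r in Ioi 0, weightedSq ψ' r < 4)
    (hD : IntegrableOn (weightedSq fun r => ψ r - ψ' r) (Ioi 0)) {a b : ℝ} (ha : 0 < a)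
    (hab : a ≤ b) :
    frameDiffSq u v w u' v' w' 2 a
        + ∫ r in a..b, frameDiffSq u v w u' v' w' 2 r / Real.sinh r
      ≤ Real.exp 12 * ∫ r in Ioi 0, weightedSq (fun r => ψ r - ψ' r) r := by
  set ρ := frameDiffSq u v w u' v' w' 2 with hρ
  have hρ0 : ∀ r, 0 ≤ ρ r := frameDiffSq_nonneg u v w u' v' w' 2
  have hlim := ((h.tendsto_frameDiffSq h' 2).add_const
    (∫ r in Ioi 0, weightedSq (fun r => ψ r - ψ' r) r)).const_mul (Real.exp 12)
  rw [zero_add] at hlim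
  refine ge_of_tendsto hlim ?_
  -- Grönwall is applied on `[a, c]`; as `c → ∞` the terminal value tends to `0`.
  filter_upwards [eventually_ge_atTop b] with c hbc
  have hac := hab.trans hbc
  have hcρ : ContinuousOn (fun r => ρ r / Real.sinh r) (Ioi 0) :=
    ContinuousOn.div_sinh (h.ac_frameDiffSq h' 2).continuousOn
  obtain ⟨k1, k2⟩ := h.integral_vertical_le hψ hM ha hac
  obtain ⟨k1', k2'⟩ := h'.integral_vertical_le hψ' hM' ha hac
  obtain ⟨d1, d2⟩ := integral_le_integral_Ioi (fun r => weightedSq_nonneg _) hD ha hac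
  have hf0 : ∀ r, 0 < r → 0 ≤ ρ r / Real.sinh r := fun r hr =>
    div_nonneg (hρ0 r) (Real.sinh_pos_iff.2 hr).le
  have key := (h.ac_frameDiffSq h' 2).backward_gronwall (K := 12)
    (F' := frameDiffSqDeriv ψ ψ' u v w u' v' w' 2)
    (f := fun r => ρ r / Real.sinh r) (d := weightedSq fun r => ψ r - ψ' r)
    (k := fun r => (v r 2 ^ 2 + w r 2 ^ 2) / Real.sinh r
      + (v' r 2 ^ 2 + w' r 2 ^ 2) / Real.sinh r)
    (by filter_upwards [h.hasDerivAt_frameDiffSq h'] with r hr using hr 2)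
    (by
      filter_upwards [ae_restrict_mem measurableSet_Ioi] with r hr
      have hs := Real.sinh_pos_iff.2 hr
      have := vertical_diff_deriv_ge (p := (ψ r).re) (q := (ψ r).im) (p' := (ψ' r).re)
        (q' := (ψ' r).im) hs (mul_inv_cancel₀ hs.ne') ((h.frame r hr).row 2)
        ((h'.frame r hr).row 2) (h.u_two_pos hψ hM hr).le (h'.u_two_pos hψ' hM' hr).le
      simp only [weightedSq_eq, Complex.sub_re, Complex.sub_im, hρ, frameDiffSq, frameDiffSqDeriv,
        frameRe, frameIm, div_eq_mul_inv]
      linarith)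
    ha hac (hρ0 c) hf0 (fun r => weightedSq_nonneg _)
    (fun r hr => by have := Real.sinh_pos_iff.2 hr; positivity)
    (k1.add k1') (hcρ.intervalIntegrable_of_pos ha hac) d1
    (by rw [intervalIntegral.integral_add k1 k1']; linarith)
  have hsplit := intervalIntegral.integral_add_adjacent_intervals
    (hcρ.intervalIntegrable_of_pos ha hab)
    (hcρ.intervalIntegrable_of_pos (ha.trans_le hab) hbc)
  have hnn : 0 ≤ ∫ r in b..c, ρ r / Real.sinh r := intervalIntegral.integral_nonneg hbc
    fun r hr => hf0 r ((ha.trans_le hab).trans_le hr.1)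
  calc ρ a + ∫ r in a..b, ρ r / Real.sinh r
      ≤ ρ a + ∫ r in a..c, ρ r / Real.sinh r := by linarith
    _ ≤ _ := key
    _ ≤ _ := by gcongr

/-- There is no good sign here, but every singular term is bounded either by `ρ / sinh r`, already
integrated in the vertical estimate, or by the squared differences times vertical energy densities.
The latter form the Grönwall weight, with exponent `96 = 8 · 12`. -/
theorem horizontal_diff_bound (h : FrameODE ψ u v w) (h' : FrameODE ψ' u' v' w')
    (hψ : IntegrableOn (weightedSq ψ) (Ioi 0)) (hM : ∫ r in Ioi 0, weightedSq ψ r < 4)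
    (hψ' : IntegrableOn (weightedSq ψ') (Ioi 0)) (hM' : ∫ r in Ioi 0, weightedSq ψ' r < 4)
    (hD : IntegrableOn (weightedSq fun r => ψ r - ψ' r) (Ioi 0)) {a : ℝ} (ha : 0 < a) :
    frameDiffSq u v w u' v' w' 0 a + frameDiffSq u v w u' v' w' 1 a
      ≤ Real.exp 96 * ((8 + 16 * Real.exp 12)
        * ∫ r in Ioi 0, weightedSq (fun r => ψ r - ψ' r) r) := by
  set ρ := frameDiffSq u v w u' v' w' 2 with hρ
  have hρ0 : ∀ r, 0 ≤ ρ r := frameDiffSq_nonneg u v w u' v' w' 2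
  set δ := ∫ r in Ioi 0, weightedSq (fun r => ψ r - ψ' r) r with hδ
  have hlim := (((h.tendsto_frameDiffSq h' 0).add (h.tendsto_frameDiffSq h' 1)).add_const
    ((8 + 16 * Real.exp 12) * δ)).const_mul (Real.exp 96)
  rw [zero_add, zero_add] at hlim
  refine ge_of_tendsto hlim ?_
  filter_upwards [eventually_ge_atTop a] with c hac
  have hcρ : ContinuousOn (fun r => ρ r / Real.sinh r) (Ioi 0) :=
    ContinuousOn.div_sinh (h.ac_frameDiffSq h' 2).continuousOn
  have hiρ := hcρ.intervalIntegrable_of_pos ha hac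
  obtain ⟨k1, k2⟩ := h.integral_vertical_le hψ hM ha hac
  obtain ⟨k1', k2'⟩ := h'.integral_vertical_le hψ' hM' ha hac
  obtain ⟨d1, d2⟩ := integral_le_integral_Ioi (fun r => weightedSq_nonneg _) hD ha hac
  have hf0 : ∀ r, 0 < r → 0 ≤ ρ r / Real.sinh r := fun r hr =>
    div_nonneg (hρ0 r) (Real.sinh_pos_iff.2 hr).le
  have key := ((h.ac_frameDiffSq h' 0).add (h.ac_frameDiffSq h' 1)).backward_gronwall (K := 96)
    (F' := fun r => frameDiffSqDeriv ψ ψ' u v w u' v' w' 0 r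
      + frameDiffSqDeriv ψ ψ' u v w u' v' w' 1 r)
    (f := fun _ => 0)
    (d := fun r => 8 * weightedSq (fun r => ψ r - ψ' r) r + 16 * (ρ r / Real.sinh r))
    (k := fun r => 8 * ((v r 2 ^ 2 + w r 2 ^ 2) / Real.sinh r
      + (v' r 2 ^ 2 + w' r 2 ^ 2) / Real.sinh r))
    (by filter_upwards [h.hasDerivAt_frameDiffSq h'] with r hr using (hr 0).add (hr 1))
    (by
      filter_upwards [ae_restrict_mem measurableSet_Ioi] with r hr
      have hs := Real.sinh_pos_iff.2 hr
      have fr := h.frame r hr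
      have fr' := h'.frame r hr
      have hst := mul_inv_cancel₀ hs.ne'
      have i0 := diff_deriv_ge (α := frameRe ψ v r) (β := frameIm ψ w r) (α' := frameRe ψ' v' r)
        (β' := frameIm ψ' w' r) (u := u r 0) (v := v r 0) (w := w r 0) (u' := u' r 0)
        (v' := v' r 0) (w' := w' r 0) hs hst rfl rfl
        (by linarith [fr.row 0, sq_nonneg (u r 0)])
      have i1 := diff_deriv_ge (α := frameRe ψ v r) (β := frameIm ψ w r) (α' := frameRe ψ' v' r)
        (β' := frameIm ψ' w' r) (u := u r 1) (v := v r 1) (w := w r 1) (u' := u' r 1)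
        (v' := v' r 1) (w' := w' r 1) hs hst rfl rfl
        (by linarith [fr.row 1, sq_nonneg (u r 1)])
      have i2 := weighted_sq_sub_le (p := (ψ r).re) (q := (ψ r).im) (p' := (ψ' r).re)
        (q' := (ψ' r).im) (v := v r 2) (w := w r 2) (v' := v' r 2) (w' := w' r 2) hs hst
      have i3 := mul_le_mul_of_nonneg_left (fr.horizontal_diff_le fr') (inv_pos.2 hs).le
      have hR : 0 ≤ frameDiffSq u v w u' v' w' 0 r + frameDiffSq u v w u' v' w' 1 r :=
        add_nonneg (frameDiffSq_nonneg ..) (frameDiffSq_nonneg ..)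
      -- The factor `u₀² + u₁²` equals `v₃² + w₃²`, since both are `1 - u₃²`; over `sinh r` it is
      -- integrable.
      have i4 : (Real.sinh r)⁻¹ * (u r 0 ^ 2 * ((v r 0 - v' r 0) ^ 2 + (w r 0 - w' r 0) ^ 2)
          + u r 1 ^ 2 * ((v r 1 - v' r 1) ^ 2 + (w r 1 - w' r 1) ^ 2))
          ≤ (Real.sinh r)⁻¹ * ((v r 2 ^ 2 + w r 2 ^ 2)
            * (frameDiffSq u v w u' v' w' 0 r + frameDiffSq u v w u' v' w' 1 r)) := by
        gcongr
        rw [show v r 2 ^ 2 + w r 2 ^ 2 = u r 0 ^ 2 + u r 1 ^ 2 by linarith [fr.uu, fr.row 2],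
          frameDiffSq, frameDiffSq]
        have m : ∀ x y : ℝ, 0 ≤ x ^ 2 * y ^ 2 := fun x y => by positivity
        linarith [m (u r 0) (u r 0 - u' r 0), m (u r 0) (u r 1 - u' r 1),
          m (u r 0) (v r 1 - v' r 1), m (u r 0) (w r 1 - w' r 1), m (u r 1) (u r 0 - u' r 0),
          m (u r 1) (u r 1 - u' r 1), m (u r 1) (v r 0 - v' r 0), m (u r 1) (w r 0 - w' r 0)]
      have i5 : 0 ≤ (Real.sinh r)⁻¹ * (v r 2 ^ 2 + w r 2 ^ 2)
          * (frameDiffSq u v w u' v' w' 0 r + frameDiffSq u v w u' v' w' 1 r) := by positivity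
      have i6 : 0 ≤ (Real.sinh r)⁻¹ * (u r 2 - u' r 2) ^ 2 := by positivity
      simp only [weightedSq_eq, Complex.sub_re, Complex.sub_im, hρ, frameDiffSq, frameDiffSqDeriv,
        frameRe, frameIm, div_eq_mul_inv] at i0 i1 i2 i3 i4 i5 ⊢
      linarith)
    ha hac (add_nonneg (frameDiffSq_nonneg ..) (frameDiffSq_nonneg ..)) (fun _ _ => le_rfl)
    (fun r hr => add_nonneg (mul_nonneg (by norm_num) (weightedSq_nonneg _ hr))
      (mul_nonneg (by norm_num) (hf0 r hr)))
    (fun r hr => by have := Real.sinh_pos_iff.2 hr; positivity)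
    ((k1.add k1').const_mul 8) intervalIntegrable_const ((d1.const_mul 8).add (hiρ.const_mul 16))
    (by rw [intervalIntegral.integral_const_mul, intervalIntegral.integral_add k1 k1']; linarith)
  have hv := h.vertical_diff_bound h' hψ hM hψ' hM' hD ha hac
  rw [intervalIntegral.integral_zero, add_zero, intervalIntegral.integral_add (d1.const_mul 8)
    (hiρ.const_mul 16), intervalIntegral.integral_const_mul,
    intervalIntegral.integral_const_mul] at key
  refine key.trans ?_
  gcongr
  linarith [hρ0 a]

theorem frameDistDensity_le (h : FrameODE ψ u v w) (h' : FrameODE ψ' u' v' w') {r : ℝ}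
    (hr : 0 < r) :
    frameDistDensity ψ ψ' u v w u' v' w' r
      ≤ 8 * weightedSq (fun r => ψ r - ψ' r) r
        + 16 * (frameDiffSq u v w u' v' w' 2 r / Real.sinh r)
        + 8 * frameEnergy ψ' v' w' r * (frameDiffSq u v w u' v' w' 0 r
          + frameDiffSq u v w u' v' w' 1 r + frameDiffSq u v w u' v' w' 2 r) := by
  have hs := Real.sinh_pos_iff.2 hr
  have fr := h.frame r hr
  have fr' := h'.frame r hr
  have hst := mul_inv_cancel₀ hs.ne'
  set α := frameRe ψ v r with hα
  set β := frameIm ψ w r with hβ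
  set α' := frameRe ψ' v' r with hα'
  set β' := frameIm ψ' w' r with hβ'
  have j1 : ∀ j, Real.sinh r * (α * v r j + β * w r j - (α' * v' r j + β' * w' r j)) ^ 2
      ≤ 2 * (Real.sinh r * ((α - α') ^ 2 + (β - β') ^ 2)) * (v r j ^ 2 + w r j ^ 2)
        + 2 * (Real.sinh r * (α' ^ 2 + β' ^ 2))
          * frameDiffSq u v w u' v' w' j r := by
    intro j
    have e : (α * v r j + β * w r j - (α' * v' r j + β' * w' r j)) ^ 2
        ≤ 2 * ((α - α') ^ 2 + (β - β') ^ 2) * (v r j ^ 2 + w r j ^ 2)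
        + 2 * (α' ^ 2 + β' ^ 2)
          * frameDiffSq u v w u' v' w' j r := by
      have c : ∀ a b x y : ℝ, (a * x + b * y) ^ 2 ≤ (a ^ 2 + b ^ 2) * (x ^ 2 + y ^ 2) :=
        fun a b x y => by linarith [sq_nonneg (a * y - b * x)]
      have d : ∀ x y : ℝ, (x + y) ^ 2 ≤ 2 * x ^ 2 + 2 * y ^ 2 :=
        fun x y => by linarith [sq_nonneg (x - y)]
      have c1 := c (α - α') (β - β') (v r j) (w r j)
      have c2 := c α' β' (v r j - v' r j) (w r j - w' r j)
      have d1 := d ((α - α') * v r j + (β - β') * w r j)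
        (α' * (v r j - v' r j) + β' * (w r j - w' r j))
      have d2 : 0 ≤ (α' ^ 2 + β' ^ 2) * (u r j - u' r j) ^ 2 := by positivity
      -- Split into the change of coefficients in the first frame and the change of frame with the
      -- second coefficients. Summing the first part over `j` uses `|v|² + |w|² = 2`; the second is
      -- bounded by the energy density of the second map.
      rw [show α * v r j + β * w r j - (α' * v' r j + β' * w' r j)
        = (α - α') * v r j + (β - β') * w r j
          + (α' * (v r j - v' r j) + β' * (w r j - w' r j)) by ring, frameDiffSq]
      linarith
    have := mul_le_mul_of_nonneg_left e hs.le
    linarith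
  have j2 := weighted_sq_sub_le (p := (ψ r).re) (q := (ψ r).im) (p' := (ψ' r).re)
    (q' := (ψ' r).im) (v := v r 2) (w := w r 2) (v' := v' r 2) (w' := w' r 2) hs hst
  have j2' : Real.sinh r * ((α - α') ^ 2 + (β - β') ^ 2)
      ≤ 2 * weightedSq (fun r => ψ r - ψ' r) r
        + 2 * (frameDiffSq u v w u' v' w' 2 r / Real.sinh r) := by
    have j3 : 0 ≤ (Real.sinh r)⁻¹ * (u r 2 - u' r 2) ^ 2 := by positivity
    simp only [weightedSq_eq, Complex.sub_re, Complex.sub_im, hα, hβ, hα', hβ', frameRe, frameIm,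
      frameDiffSq, div_eq_mul_inv]
    linarith
  have j4 : ((u r 0 - u' r 0) ^ 2 + (u r 1 - u' r 1) ^ 2) / Real.sinh r
      ≤ 8 * (frameDiffSq u v w u' v' w' 2 r / Real.sinh r)
        + 8 * ((v' r 2 ^ 2 + w' r 2 ^ 2) / Real.sinh r)
          * (frameDiffSq u v w u' v' w' 0 r + frameDiffSq u v w u' v' w' 1 r) := by
    have := mul_le_mul_of_nonneg_left (fr.horizontal_diff_le fr') (inv_pos.2 hs).le
    simp only [frameDiffSq, div_eq_mul_inv]
    linarith
  have hX : 0 ≤ Real.sinh r * ((α - α') ^ 2 + (β - β') ^ 2) := by positivity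
  have hY : 0 ≤ Real.sinh r * (α' ^ 2 + β' ^ 2) := by positivity
  have hZ : 0 ≤ (v' r 2 ^ 2 + w' r 2 ^ 2) / Real.sinh r := by positivity
  have d0 := frameDiffSq_nonneg u v w u' v' w' 0 r
  have d1 := frameDiffSq_nonneg u v w u' v' w' 1 r
  have d2 := frameDiffSq_nonneg u v w u' v' w' 2 r
  have hsum : (v r 0 ^ 2 + w r 0 ^ 2) + (v r 1 ^ 2 + w r 1 ^ 2) + (v r 2 ^ 2 + w r 2 ^ 2) = 2 := by
    linarith [fr.vv, fr.ww]
  have k1 : Real.sinh r * ∑ j, (α * v r j + β * w r j - (α' * v' r j + β' * w' r j)) ^ 2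
      ≤ 2 * (Real.sinh r * ((α - α') ^ 2 + (β - β') ^ 2))
          * ((v r 0 ^ 2 + w r 0 ^ 2) + (v r 1 ^ 2 + w r 1 ^ 2) + (v r 2 ^ 2 + w r 2 ^ 2))
        + 2 * (Real.sinh r * (α' ^ 2 + β' ^ 2)) * (frameDiffSq u v w u' v' w' 0 r
          + frameDiffSq u v w u' v' w' 1 r + frameDiffSq u v w u' v' w' 2 r) := by
    rw [Fin.sum_univ_three]
    linarith [j1 0, j1 1, j1 2]
  rw [hsum] at k1
  have p1 : 0 ≤ Real.sinh r * (α' ^ 2 + β' ^ 2) * (frameDiffSq u v w u' v' w' 0 r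
          + frameDiffSq u v w u' v' w' 1 r + frameDiffSq u v w u' v' w' 2 r) := by positivity
  have p2 : 0 ≤ (v' r 2 ^ 2 + w' r 2 ^ 2) / Real.sinh r * frameDiffSq u v w u' v' w' 2 r := by
    positivity
  have hE : frameEnergy ψ' v' w' r = Real.sinh r * (α' ^ 2 + β' ^ 2)
      + (v' r 2 ^ 2 + w' r 2 ^ 2) / Real.sinh r := rfl
  rw [frameDistDensity, ← hα, ← hβ, ← hα', ← hβ', hE]
  linarith

/-- The absolute constant in the Lipschitz estimate. -/
noncomputable def _root_.frameDistConst : ℝ :=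
  8 + 16 * Real.exp 12 + 48 * (Real.exp 96 * (8 + 16 * Real.exp 12) + Real.exp 12)

/-- The pointwise frame differences are uniformly at most `c δ`, so their product with the energy
density integrates to at most `6 c δ`; with the prefactor `8` this is the `48` in `frameDistConst`.
-/
theorem integral_frameDistDensity_le (h : FrameODE ψ u v w) (h' : FrameODE ψ' u' v' w')
    (hψ : IntegrableOn (weightedSq ψ) (Ioi 0)) (hM : ∫ r in Ioi 0, weightedSq ψ r < 4)
    (hψ' : IntegrableOn (weightedSq ψ') (Ioi 0)) (hM' : ∫ r in Ioi 0, weightedSq ψ' r < 4)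
    (hD : IntegrableOn (weightedSq fun r => ψ r - ψ' r) (Ioi 0)) :
    ∫⁻ r in Ioi 0, ENNReal.ofReal (frameDistDensity ψ ψ' u v w u' v' w' r)
      ≤ ENNReal.ofReal (frameDistConst
        * ∫ r in Ioi 0, weightedSq (fun r => ψ r - ψ' r) r) := by
  set δ := ∫ r in Ioi 0, weightedSq (fun r => ψ r - ψ' r) r with hδ
  set ρ := frameDiffSq u v w u' v' w' 2 with hρ
  set c := Real.exp 96 * (8 + 16 * Real.exp 12) + Real.exp 12 with hc
  have hδ0 : 0 ≤ δ := setIntegral_nonneg measurableSet_Ioi fun r => weightedSq_nonneg _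
  have hc0 : 0 ≤ c := by positivity
  have hf0 : ∀ r, 0 < r → 0 ≤ ρ r / Real.sinh r := fun r hr =>
    div_nonneg (frameDiffSq_nonneg ..) (Real.sinh_pos_iff.2 hr).le
  have hcρ : ContinuousOn (fun r => ρ r / Real.sinh r) (Ioi 0) :=
    ContinuousOn.div_sinh (h.ac_frameDiffSq h' 2).continuousOn
  obtain ⟨e1, e2⟩ := h'.integrable_frameEnergy hψ' hM'
  obtain ⟨r1, r2⟩ := integrableOn_Ioi_of_bounded (C := Real.exp 12 * δ) hf0
    (fun a b ha hab => hcρ.intervalIntegrable_of_pos ha hab) (fun a b ha hab => by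
      have h1 := h.vertical_diff_bound h' hψ hM hψ' hM' hD ha hab
      have h2 := frameDiffSq_nonneg u v w u' v' w' 2 a
      linarith)
  have hle : ∀ r, 0 < r → frameDistDensity ψ ψ' u v w u' v' w' r
      ≤ 8 * weightedSq (fun r => ψ r - ψ' r) r + 16 * (ρ r / Real.sinh r)
        + 8 * (c * δ) * frameEnergy ψ' v' w' r := by
    intro r hr
    refine (h.frameDistDensity_le h' hr).trans ?_
    have h1 := h.vertical_diff_bound h' hψ hM hψ' hM' hD hr le_rfl
    rw [intervalIntegral.integral_same, add_zero] at h1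
    have h2 := h.horizontal_diff_bound h' hψ hM hψ' hM' hD hr
    have h3 : frameDiffSq u v w u' v' w' 0 r + frameDiffSq u v w u' v' w' 1 r
        + frameDiffSq u v w u' v' w' 2 r ≤ c * δ := by
      rw [hc]; linarith
    have h4 := mul_le_mul_of_nonneg_left h3 (frameEnergy_nonneg ψ' v' w' hr)
    linarith
  have i1 : Integrable (fun r => 8 * weightedSq (fun r => ψ r - ψ' r) r)
    (volume.restrict (Ioi 0)) := Integrable.const_mul hD 8
  have i2 : Integrable (fun r => 16 * (ρ r / Real.sinh r)) (volume.restrict (Ioi 0)) :=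
    Integrable.const_mul r1 16
  have i3 : Integrable (fun r => 8 * (c * δ) * frameEnergy ψ' v' w' r)
    (volume.restrict (Ioi 0)) := Integrable.const_mul e1 _
  calc ∫⁻ r in Ioi 0, ENNReal.ofReal (frameDistDensity ψ ψ' u v w u' v' w' r)
      ≤ ∫⁻ r in Ioi 0, ENNReal.ofReal (8 * weightedSq (fun r => ψ r - ψ' r) r
        + 16 * (ρ r / Real.sinh r) + 8 * (c * δ) * frameEnergy ψ' v' w' r) := by
        refine setLIntegral_mono' measurableSet_Ioi fun r hr => ?_
        exact ENNReal.ofReal_le_ofReal (hle r hr)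
    _ = ENNReal.ofReal (∫ r in Ioi 0, (8 * weightedSq (fun r => ψ r - ψ' r) r
        + 16 * (ρ r / Real.sinh r) + 8 * (c * δ) * frameEnergy ψ' v' w' r)) := by
        refine (ofReal_integral_eq_lintegral_ofReal ((i1.add i2).add i3) ?_).symm
        filter_upwards [ae_restrict_mem measurableSet_Ioi] with r hr
        have h1 := hf0 r hr
        have h2 := frameEnergy_nonneg ψ' v' w' hr
        have h3 := weightedSq_nonneg (fun r => ψ r - ψ' r) hr
        have h4 := mul_nonneg (mul_nonneg hc0 hδ0) h2
        simp only [Pi.zero_apply, Pi.add_apply]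
        linarith
    _ ≤ _ := by
        refine ENNReal.ofReal_le_ofReal ?_
        have s1 := integral_add (i1.add i2) i3
        simp only [Pi.add_apply] at s1
        rw [s1, integral_add i1 i2, integral_const_mul,
          integral_const_mul, integral_const_mul, ← hδ]
        have := mul_le_mul_of_nonneg_left e2 (mul_nonneg hc0 hδ0)
        rw [frameDistConst]
        linarith

end FrameODE

/-! ### Solving differential equations from infinity. -/

theorem continuousOn_integral_Ioi {E : Type*} [NormedAddCommGroup E] [NormedSpace ℝ E] {f : ℝ → E}
    (hf : ∀ a, 0 < a → IntegrableOn f (Ioi a)) :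
    ContinuousOn (fun r => ∫ s in Ioi r, f s) (Ioi 0) := by
  intro x hx
  have hx : 0 < x := hx
  have h := (hf (x / 2) (by positivity)).continuousOn_Ici_primitive_Ioi x (half_le_self hx.le)
  exact (h.continuousAt (Ici_mem_nhds (by linarith))).continuousWithinAt

/-- The weight in the contraction argument for ordinary differential equations. -/
theorem integral_mul_exp_weight {k : ℝ → ℝ} (hk0 : ∀ r, 0 < r → 0 ≤ k r)
    (hk : ∀ a, 0 < a → IntegrableOn k (Ioi a)) {r : ℝ} (hr : 0 < r) :
    IntegrableOn (fun s => k s * Real.exp (2 * ∫ t in Ioi s, k t)) (Ioi r) ∧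
      ∫ s in Ioi r, k s * Real.exp (2 * ∫ t in Ioi s, k t)
        ≤ Real.exp (2 * ∫ t in Ioi r, k t) / 2 := by
  have hcont : ContinuousOn (fun s => Real.exp (2 * ∫ t in Ioi s, k t)) (Ioi 0) :=
    Real.continuous_exp.comp_continuousOn
      (continuousOn_const.mul (continuousOn_integral_Ioi hk))
  have hint : IntegrableOn (fun s => k s * Real.exp (2 * ∫ t in Ioi s, k t)) (Ioi r) := by
    refine (hk r hr).mul_bdd (c := Real.exp (2 * ∫ t in Ioi r, k t))
      ((hcont.mono (Ioi_subset_Ioi hr.le)).aestronglyMeasurable measurableSet_Ioi) ?_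
    filter_upwards [ae_restrict_mem measurableSet_Ioi] with s hs
    rw [Real.norm_of_nonneg (Real.exp_pos _).le, Real.exp_le_exp]
    refine mul_le_mul_of_nonneg_left (setIntegral_mono_set (hk r hr) ?_
      (Ioi_subset_Ioi (le_of_lt hs)).eventuallyLE) zero_le_two
    filter_upwards [ae_restrict_mem measurableSet_Ioi] with t ht using hk0 t (hr.trans ht)
  refine ⟨hint, le_of_tendsto (intervalIntegral_tendsto_integral_Ioi r hint tendsto_id) ?_⟩
  filter_upwards [eventually_ge_atTop r] with b hb
  have hkb : IntervalIntegrable (fun s => -2 * k s) volume r b :=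
    ((intervalIntegrable_iff_integrableOn_Ioc_of_le hb).2
      ((hk r hr).mono_set Ioc_subset_Ioi_self)).const_mul (-2)
  -- The integrating-factor formula for the constant function `1` and weight `-2k` is the exact
  -- primitive of the integrand, up to a constant factor.
  have h1 := ((ACOnPos.const 1).integral_exp_mul (F' := fun _ => 0)
    (Eventually.of_forall fun s => hasDerivAt_const s 1) hr hb hkb).2
  have h2 : ∀ s ∈ uIcc r b, Real.exp (∫ t in r..s, -2 * k t) * (0 + -2 * k s * 1)
      = -2 * (Real.exp (2 * ∫ t in Ioi r, k t))⁻¹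
        * (k s * Real.exp (2 * ∫ t in Ioi s, k t)) := by
    intro s hs
    rw [uIcc_of_le hb] at hs
    rw [intervalIntegral.integral_const_mul,
      ← intervalIntegral.integral_Ioi_sub_Ioi (hk r hr) hs.1, ← Real.exp_neg,
      show -2 * ((∫ t in Ioi r, k t) - ∫ t in Ioi s, k t)
        = -(2 * (∫ t in Ioi r, k t)) + 2 * ∫ t in Ioi s, k t by ring, Real.exp_add]
    ring
  rw [intervalIntegral.integral_congr h2, intervalIntegral.integral_const_mul] at h1
  have h3 := Real.exp_pos (2 * ∫ t in Ioi r, k t)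
  have h4 := Real.exp_pos (∫ t in r..b, -2 * k t)
  set A := ∫ s in r..b, k s * Real.exp (2 * ∫ t in Ioi s, k t)
  set B := Real.exp (2 * ∫ t in Ioi r, k t)
  set D := Real.exp (∫ t in r..b, -2 * k t)
  have h5 : 2 * A = B * (1 - D) := by
    field_simp at h1
    linarith
  simp only [id]
  nlinarith

/-- Carathéodory's existence theorem for a linearly growing equation on `(0, ∞)` with prescribed
value at infinity. -/
theorem exists_integral_solution {E : Type*} [NormedAddCommGroup E] [NormedSpace ℝ E]
    [CompleteSpace E] {Φ : ℝ → E → E} {k : ℝ → ℝ} (e : E) (hk0 : ∀ r, 0 < r → 0 ≤ k r)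
    (hk : ∀ a, 0 < a → IntegrableOn k (Ioi a)) (hΦ0 : ∀ r, 0 < r → Φ r 0 = 0)
    (hΦ : ∀ r, 0 < r → ∀ x y, ‖Φ r x - Φ r y‖ ≤ k r * ‖x - y‖)
    (hm : ∀ f : ℝ → E, ContinuousOn f (Ioi 0) →
      AEStronglyMeasurable (fun r => Φ r (f r)) (volume.restrict (Ioi 0))) :
    ∃ f : ℝ → E, ∀ r, 0 < r → IntegrableOn (fun s => Φ s (f s)) (Ioi r) ∧
      f r = e - ∫ s in Ioi r, Φ s (f s) := by
  -- `k` need not be integrable at `0`, so solutions may blow up there. In the norm `sup |f| / W`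
  -- the integral operator contracts with constant `1/2`; the unknown is the bounded quotient `g = f
  -- / W`.
  set W : ℝ → ℝ := fun r => Real.exp (2 * ∫ t in Ioi r, k t) with hW
  have hWpos : ∀ r, 0 < W r := fun r => Real.exp_pos _
  have hWone : ∀ r, 0 < r → 1 ≤ W r := fun r hr => Real.one_le_exp
    (mul_nonneg zero_le_two (setIntegral_nonneg measurableSet_Ioi fun t ht => hk0 t (hr.trans ht)))
  have hWc : ContinuousOn W (Ioi 0) :=
    Real.continuous_exp.comp_continuousOn
      (continuousOn_const.mul (continuousOn_integral_Ioi hk))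
  have hkW := fun r hr => integral_mul_exp_weight hk0 hk (r := r) hr
  let X := BoundedContinuousFunction (Ioi (0 : ℝ)) E
  let ext : X → ℝ → E := fun g s => if h : 0 < s then W s • g ⟨s, h⟩ else 0
  have hext : ∀ (g : X) (s : ℝ) (h : 0 < s), ext g s = W s • g ⟨s, h⟩ := fun g s h => dif_pos h
  have hextc : ∀ g : X, ContinuousOn (ext g) (Ioi 0) := by
    intro g
    rw [continuousOn_iff_continuous_domRestrict]
    have : (Ioi (0 : ℝ)).domRestrict (ext g) = fun s : Ioi (0 : ℝ) => W s • g s := by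
      funext s
      exact hext g s s.2
    rw [this]
    exact (continuousOn_iff_continuous_domRestrict.1 hWc).smul g.continuous
  have hextd : ∀ (g g' : X) (s : ℝ), 0 < s → ‖ext g s - ext g' s‖ ≤ W s * ‖g - g'‖ := by
    intro g g' s hs
    rw [hext g s hs, hext g' s hs, ← smul_sub, norm_smul, Real.norm_of_nonneg (hWpos s).le]
    exact mul_le_mul_of_nonneg_left ((g - g').norm_coe_le_norm ⟨s, hs⟩) (hWpos s).le
  have hext0 : ∀ s, 0 < s → ext 0 s = 0 := fun s hs =>
    (hext 0 s hs).trans (smul_zero _)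
  have hΦd : ∀ (g g' : X) (s : ℝ), 0 < s →
      ‖Φ s (ext g s) - Φ s (ext g' s)‖ ≤ k s * W s * ‖g - g'‖ := by
    intro g g' s hs
    refine (hΦ s hs _ _).trans ?_
    rw [mul_assoc]
    exact mul_le_mul_of_nonneg_left (hextd g g' s hs) (hk0 s hs)
  have hΦn : ∀ (g : X) (s : ℝ), 0 < s → ‖Φ s (ext g s)‖ ≤ k s * W s * ‖g‖ := by
    intro g s hs
    have := hΦd g 0 s hs
    rwa [hext0 s hs, hΦ0 s hs, sub_zero, sub_zero] at this
  have hint : ∀ (g : X) (r : ℝ), 0 < r → IntegrableOn (fun s => Φ s (ext g s)) (Ioi r) := by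
    intro g r hr
    refine Integrable.mono' ((hkW r hr).1.mul_const ‖g‖)
      ((hm _ (hextc g)).mono_measure (Measure.restrict_mono (Ioi_subset_Ioi hr.le) le_rfl)) ?_
    filter_upwards [ae_restrict_mem measurableSet_Ioi] with s hs using hΦn g s (hr.trans hs)
  have hTd : ∀ (g g' : X) (r : ℝ), 0 < r →
      ‖(∫ s in Ioi r, Φ s (ext g s)) - ∫ s in Ioi r, Φ s (ext g' s)‖
        ≤ W r * (1 / 2 * ‖g - g'‖) := by
    intro g g' r hr
    rw [← integral_sub (hint g r hr) (hint g' r hr)]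
    refine (norm_integral_le_of_norm_le ((hkW r hr).1.mul_const ‖g - g'‖) ?_).trans ?_
    · filter_upwards [ae_restrict_mem measurableSet_Ioi] with s hs using
        hΦd g g' s (hr.trans hs)
    · rw [integral_mul_const]
      have := mul_le_mul_of_nonneg_right (hkW r hr).2 (norm_nonneg (g - g'))
      linarith
  let T : X → X := fun g => BoundedContinuousFunction.ofNormedAddCommGroup
    (fun r : Ioi (0 : ℝ) => (W r)⁻¹ • (e - ∫ s in Ioi (r : ℝ), Φ s (ext g s)))
    (((continuousOn_iff_continuous_domRestrict.1 hWc).inv₀ fun r => (hWpos r).ne').smul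
      (continuous_const.sub (continuousOn_iff_continuous_domRestrict.1
        (continuousOn_integral_Ioi (hint g)))))
    (‖e‖ + 1 / 2 * ‖g‖) (by
      intro r
      have hr : 0 < (r : ℝ) := r.2
      have h1 := hTd g 0 r hr
      have h2 : ∫ s in Ioi (r : ℝ), Φ s (ext 0 s) = 0 := by
        refine setIntegral_eq_zero_of_forall_eq_zero fun s hs => ?_
        rw [hext0 s (hr.trans hs), hΦ0 s (hr.trans hs)]
      rw [h2, sub_zero, sub_zero] at h1
      rw [norm_smul, norm_inv, Real.norm_of_nonneg (hWpos r).le, inv_mul_le_iff₀ (hWpos r)]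
      refine (norm_sub_le _ _).trans ?_
      have h3 := mul_le_mul_of_nonneg_right (hWone r hr) (norm_nonneg e)
      linarith)
  have hT : ∀ (g : X) (r : Ioi (0 : ℝ)),
      T g r = (W r)⁻¹ • (e - ∫ s in Ioi (r : ℝ), Φ s (ext g s)) := fun g r => rfl
  have hcon : ContractingWith (1 / 2) T := by
    refine ⟨by norm_num [← NNReal.coe_lt_coe], LipschitzWith.of_dist_le_mul fun g g' => ?_⟩
    rw [BoundedContinuousFunction.dist_le (by positivity)]
    intro r
    have h1 := hTd g' g r r.2
    rw [dist_eq_norm, hT, hT, ← smul_sub, sub_sub_sub_cancel_left, norm_smul, norm_inv,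
      Real.norm_of_nonneg (hWpos r).le, inv_mul_le_iff₀ (hWpos r), dist_comm, dist_eq_norm]
    simpa using h1
  let g := hcon.fixedPoint T
  have hg : T g = g := hcon.fixedPoint_isFixedPt
  refine ⟨ext g, fun r hr => ⟨hint g r hr, ?_⟩⟩
  have h1 : g ⟨r, hr⟩ = (W r)⁻¹ • (e - ∫ s in Ioi r, Φ s (ext g s)) := by
    conv_lhs => rw [← hg]
    rfl
  rw [hext g r hr, h1, smul_inv_smul₀ (hWpos r).ne']

theorem AbsolutelyContinuousOnInterval.congr {X : Type*} [PseudoMetricSpace X] {f g : ℝ → X}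
    {a b : ℝ} (hf : AbsolutelyContinuousOnInterval f a b) (h : EqOn f g (uIcc a b)) :
    AbsolutelyContinuousOnInterval g a b := by
  refine Tendsto.congr' ?_ hf
  rw [EventuallyEq, eventually_inf_principal]
  filter_upwards with E hE
  refine Finset.sum_congr rfl fun i hi => ?_
  rw [h (hE.1 i hi).1, h (hE.1 i hi).2]

/-- An indefinite integral on `(0, ∞)` is locally absolutely continuous and differentiable almost
everywhere. -/
theorem acOnPos_of_integral {f F : ℝ → ℝ} (hF : ∀ a, 0 < a → IntegrableOn F (Ioi a)) {e : ℝ}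
    (hf : ∀ r, 0 < r → f r = e - ∫ s in Ioi r, F s) :
    ACOnPos f ∧ (∀ᵐ r ∂(volume.restrict (Ioi (0 : ℝ))), HasDerivAt f (F r) r) ∧
      Tendsto f atTop (𝓝 e) := by
  have hint : ∀ a b, 0 < a → a ≤ b → IntervalIntegrable F volume a b := fun a b ha hab =>
    (intervalIntegrable_iff_integrableOn_Ioc_of_le hab).2 ((hF a ha).mono_set Ioc_subset_Ioi_self)
  have heq : ∀ a b, 0 < a → a ≤ b → f a + ∫ s in a..b, F s = f b := fun a b ha hab => by
    rw [hf a ha, hf b (ha.trans_le hab), ← intervalIntegral.integral_Ioi_sub_Ioi (hF a ha) hab]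
    ring
  refine ⟨fun a b ha hab => ?_, ?_, ?_⟩
  · refine ((absolutelyContinuousOnInterval_const (f a) a b).fun_add
      ((hint a b ha hab).absolutelyContinuousOnInterval_intervalIntegral left_mem_uIcc)).congr ?_
    intro x hx
    rw [uIcc_of_le hab] at hx
    exact heq a x ha hx.1
  · rw [ae_restrict_iff' measurableSet_Ioi]
    have h := ae_all_iff.2 fun n : ℕ =>
      (hint _ _ (by positivity) (one_div_add_one_le n)).ae_hasDerivAt_integral
    filter_upwards [h] with x hx hx0
    have hx0 : 0 < x := hx0
    obtain ⟨n, hn⟩ := exists_nat_gt (max x (1 / x))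
    have h1 : x < n := (le_max_left _ _).trans_lt hn
    have h2 : 1 / x < n := (le_max_right _ _).trans_lt hn
    have h3 : 1 / ((n : ℝ) + 1) < x := by
      rw [div_lt_iff₀ (by positivity)]
      rw [div_lt_iff₀ hx0] at h2
      nlinarith
    have h4 := hx n (by
      rw [uIcc_of_le (one_div_add_one_le n)]
      exact ⟨h3.le, by linarith⟩) _ left_mem_uIcc
    refine (h4.const_add (f (1 / ((n : ℝ) + 1)))).congr_of_eventuallyEq ?_
    filter_upwards [Ioi_mem_nhds h3] with y hy
    exact (heq _ y (by positivity) (le_of_lt hy)).symm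
  · have h1 := (tendsto_integral_Ioi_zero (μ := volume) (f := F) tendsto_id).const_sub e
    rw [sub_zero] at h1
    refine h1.congr' ?_
    filter_upwards [eventually_gt_atTop 0] with r hr
    exact (hf r hr).symm

/-! ### The linear spinor system and the frame it generates. -/

theorem integrableOn_inv_sinh_Ioi {a : ℝ} (ha : 0 < a) :
    IntegrableOn (fun r => (Real.sinh r)⁻¹) (Ioi a) := by
  have hc : 0 < (1 - Real.exp (-2 * a)) / 2 := by
    have : Real.exp (-2 * a) < 1 := by
      rw [← Real.exp_zero, Real.exp_lt_exp]
      linarith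
    linarith
  refine Integrable.mono' ((integrableOn_exp_neg_Ioi a).const_mul ((1 - Real.exp (-2 * a)) / 2)⁻¹)
    Real.measurable_sinh.inv.aestronglyMeasurable ?_
  filter_upwards [ae_restrict_mem measurableSet_Ioi] with r hr
  have hr : a < r := hr
  have hs := Real.sinh_pos_iff.2 (ha.trans hr)
  rw [Real.norm_of_nonneg (inv_nonneg.2 hs.le), Real.exp_neg, ← mul_inv]
  refine inv_anti₀ (mul_pos hc (Real.exp_pos r)) ?_
  have h1 : Real.exp (-r) = Real.exp r * Real.exp (-2 * r) := by
    rw [← Real.exp_add]; congr 1; ring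
  have h2 : Real.exp (-2 * r) ≤ Real.exp (-2 * a) := Real.exp_le_exp.2 (by linarith)
  have h3 := mul_le_mul_of_nonneg_left h2 (Real.exp_pos r).le
  rw [Real.sinh_eq, h1]
  linarith

/-- From `2|ψ| ≤ |ψ|² sinh r + 1 / sinh r`, where the last term is integrable away from the origin.
This lets the linear system start at infinity. -/
theorem integrableOn_norm_of_weightedSq {ψ : ℝ → ℂ}
    (hm : AEStronglyMeasurable ψ (volume.restrict (Ioi 0)))
    (hψ : IntegrableOn (weightedSq ψ) (Ioi 0)) {a : ℝ} (ha : 0 < a) :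
    IntegrableOn (fun r => ‖ψ r‖) (Ioi a) := by
  refine Integrable.mono' ((hψ.mono_set (Ioi_subset_Ioi ha.le)).add (integrableOn_inv_sinh_Ioi ha))
    ((hm.mono_measure (Measure.restrict_mono (Ioi_subset_Ioi ha.le) le_rfl)).norm) ?_
  filter_upwards [ae_restrict_mem measurableSet_Ioi] with r hr
  have hs := Real.sinh_pos_iff.2 (ha.trans hr)
  have h1 : 0 ≤ (Real.sinh r)⁻¹ * (‖ψ r‖ * Real.sinh r - 1) ^ 2 := by positivity
  have h2 : (Real.sinh r)⁻¹ * (‖ψ r‖ * Real.sinh r - 1) ^ 2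
      = weightedSq ψ r + (Real.sinh r)⁻¹ - 2 * ‖ψ r‖ := by
    rw [weightedSq]
    field_simp
    ring
  rw [norm_norm, Pi.add_apply]
  linarith [norm_nonneg (ψ r)]

/-- The right-hand side of the linear system `x' = x / (2 sinh r) - ψ y / 2`,
`y' = ψ̄ x / 2 - y / (2 sinh r)` for `z = (Re x, Im x, Re y, Im y)`. -/
noncomputable def spinorField (ψ : ℝ → ℂ) (r : ℝ) (z : Fin 4 → ℝ) : Fin 4 → ℝ :=
  ![z 0 / (2 * Real.sinh r) - ((ψ r).re * z 2 - (ψ r).im * z 3) / 2,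
    z 1 / (2 * Real.sinh r) - ((ψ r).re * z 3 + (ψ r).im * z 2) / 2,
    ((ψ r).re * z 0 + (ψ r).im * z 1) / 2 - z 2 / (2 * Real.sinh r),
    ((ψ r).re * z 1 - (ψ r).im * z 0) / 2 - z 3 / (2 * Real.sinh r)]

theorem spinorField_sub (ψ : ℝ → ℂ) (r : ℝ) (z z' : Fin 4 → ℝ) :
    spinorField ψ r z - spinorField ψ r z' = spinorField ψ r (z - z') := by
  funext j
  fin_cases j <;> simp [spinorField] <;> ring

theorem norm_spinorField_le (ψ : ℝ → ℂ) {r : ℝ} (hr : 0 < r) (z : Fin 4 → ℝ) :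
    ‖spinorField ψ r z‖ ≤ ((Real.sinh r)⁻¹ + ‖ψ r‖) * ‖z‖ := by
  have hs := Real.sinh_pos_iff.2 hr
  rw [pi_norm_le_iff_of_nonneg (by positivity)]
  have hp := Complex.abs_re_le_norm (ψ r)
  have hq := Complex.abs_im_le_norm (ψ r)
  have hz : ∀ j, |z j| ≤ ‖z‖ := fun j => norm_le_pi_norm z j
  have hpz : ∀ j, |(ψ r).re * z j| ≤ ‖ψ r‖ * ‖z‖ := fun j => by
    rw [abs_mul]; exact mul_le_mul hp (hz j) (abs_nonneg _) (norm_nonneg _)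
  have hqz : ∀ j, |(ψ r).im * z j| ≤ ‖ψ r‖ * ‖z‖ := fun j => by
    rw [abs_mul]; exact mul_le_mul hq (hz j) (abs_nonneg _) (norm_nonneg _)
  have hsz : ∀ j, |z j / (2 * Real.sinh r)| ≤ (Real.sinh r)⁻¹ * ‖z‖ := fun j => by
    rw [abs_div, abs_of_pos (by positivity : 0 < 2 * Real.sinh r), div_le_iff₀ (by positivity)]
    have : (Real.sinh r)⁻¹ * ‖z‖ * (2 * Real.sinh r) = 2 * ‖z‖ := by field_simp
    linarith [hz j, norm_nonneg z]
  intro j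
  rw [Real.norm_eq_abs, add_mul]
  have p := fun j => abs_le.1 (hpz j)
  have q := fun j => abs_le.1 (hqz j)
  have s := fun j => abs_le.1 (hsz j)
  rw [abs_le]
  fin_cases j <;> simp only [spinorField] <;> constructor <;>
    simp only [Fin.zero_eta, Fin.mk_one, Fin.reduceFinMk, Matrix.cons_val] <;>
    linarith [(p 0).1, (p 0).2, (p 1).1, (p 1).2, (p 2).1, (p 2).2, (p 3).1, (p 3).2, (q 0).1,
      (q 0).2, (q 1).1, (q 1).2, (q 2).1, (q 2).2, (q 3).1, (q 3).2, (s 0).1, (s 0).2, (s 1).1,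
      (s 1).2, (s 2).1, (s 2).2, (s 3).1, (s 3).2]

theorem aestronglyMeasurable_spinorField {ψ : ℝ → ℂ}
    (hm : AEStronglyMeasurable ψ (volume.restrict (Ioi 0))) {z : ℝ → Fin 4 → ℝ}
    (hz : ContinuousOn z (Ioi 0)) :
    AEStronglyMeasurable (fun r => spinorField ψ r (z r)) (volume.restrict (Ioi 0)) := by
  have hzj : ∀ j, AEMeasurable (fun r => z r j) (volume.restrict (Ioi 0)) := fun j =>
    ((continuousOn_pi.1 hz j).aestronglyMeasurable measurableSet_Ioi).aemeasurable
  have hs : AEMeasurable (fun r => 2 * Real.sinh r) (volume.restrict (Ioi 0)) :=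
    (Real.measurable_sinh.const_mul 2).aemeasurable
  have hp := hm.aemeasurable.re
  have hq := hm.aemeasurable.im
  refine (aemeasurable_pi_iff.2 fun j => ?_).aestronglyMeasurable
  fin_cases j
  · exact ((hzj 0).div hs).sub (((hp.mul (hzj 2)).sub (hq.mul (hzj 3))).div_const 2)
  · exact ((hzj 1).div hs).sub (((hp.mul (hzj 3)).add (hq.mul (hzj 2))).div_const 2)
  · exact (((hp.mul (hzj 0)).add (hq.mul (hzj 1))).div_const 2).sub ((hzj 2).div hs)
  · exact (((hp.mul (hzj 1)).sub (hq.mul (hzj 0))).div_const 2).sub ((hzj 3).div hs)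

/-- A solution of the linear system with `x = 0`, `y = 1` at infinity. -/
structure IsSpinor (ψ : ℝ → ℂ) (z : ℝ → Fin 4 → ℝ) : Prop where
  ac : ∀ j, ACOnPos fun r => z r j
  deriv : ∀ᵐ r ∂(volume.restrict (Ioi (0 : ℝ))), ∀ j,
    HasDerivAt (fun r => z r j) (spinorField ψ r (z r) j) r
  tendsto : ∀ j, Tendsto (fun r => z r j) atTop (𝓝 ((![0, 0, 1, 0] : Fin 4 → ℝ) j))

theorem exists_isSpinor {ψ : ℝ → ℂ} (hm : AEStronglyMeasurable ψ (volume.restrict (Ioi 0)))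
    (hψ : IntegrableOn (weightedSq ψ) (Ioi 0)) : ∃ z, IsSpinor ψ z := by
  obtain ⟨z, hz⟩ := exists_integral_solution (Φ := spinorField ψ)
    (k := fun r => (Real.sinh r)⁻¹ + ‖ψ r‖) ![0, 0, 1, 0]
    (fun r hr => by have := Real.sinh_pos_iff.2 hr; positivity)
    (fun a ha => (integrableOn_inv_sinh_Ioi ha).add (integrableOn_norm_of_weightedSq hm hψ ha))
    (fun r _ => by funext j; fin_cases j <;> simp [spinorField])
    (fun r hr x y => by rw [spinorField_sub]; exact norm_spinorField_le ψ hr _)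
    (fun f hf => aestronglyMeasurable_spinorField hm hf)
  have key := fun j => acOnPos_of_integral (f := fun r => z r j)
    (F := fun r => spinorField ψ r (z r) j) (e := (![0, 0, 1, 0] : Fin 4 → ℝ) j)
    (fun a ha => (ContinuousLinearMap.proj (R := ℝ) (φ := fun _ : Fin 4 => ℝ) j).integrable_comp
      (hz a ha).1)
    (fun r hr => by
      have h1 := (ContinuousLinearMap.proj (R := ℝ) (φ := fun _ : Fin 4 => ℝ) j).integral_comp_comm
        (hz r hr).1
      simp only [ContinuousLinearMap.proj_apply] at h1
      rw [h1]
      exact congrFun (hz r hr).2 j)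
  exact ⟨z, fun j => (key j).1, ae_all_iff.2 fun j => (key j).2.1, fun j => (key j).2.2⟩

/-- The squared norm of a spinor. -/
def spinorNormSq (z : Fin 4 → ℝ) : ℝ := z 0 * z 0 + z 1 * z 1 + (z 2 * z 2 + z 3 * z 3)

/-- The orthonormal frame of `ℝ³` determined by a nonzero spinor. -/
noncomputable def spinorU (z : Fin 4 → ℝ) : Fin 3 → ℝ :=
  ![-2 * (z 0 * z 2 - z 1 * z 3) / spinorNormSq z, -2 * (z 0 * z 3 + z 1 * z 2) / spinorNormSq z,
    (z 2 * z 2 + z 3 * z 3 - (z 0 * z 0 + z 1 * z 1)) / spinorNormSq z]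

noncomputable def spinorV (z : Fin 4 → ℝ) : Fin 3 → ℝ :=
  ![(z 2 * z 2 - z 3 * z 3 - (z 0 * z 0 - z 1 * z 1)) / spinorNormSq z,
    2 * (z 2 * z 3 - z 0 * z 1) / spinorNormSq z, 2 * (z 0 * z 2 + z 1 * z 3) / spinorNormSq z]

noncomputable def spinorW (z : Fin 4 → ℝ) : Fin 3 → ℝ :=
  ![-2 * (z 0 * z 1 + z 2 * z 3) / spinorNormSq z,
    (z 0 * z 0 - z 1 * z 1 + (z 2 * z 2 - z 3 * z 3)) / spinorNormSq z,
    2 * (z 1 * z 2 - z 0 * z 3) / spinorNormSq z]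

/-- This is the double cover of the rotation group by unit spinors. With `x = z₀ + i z₁`, `y = z₂ +
i z₃` and `N = |x|² + |y|²`, one has `u₀ + i u₁ = -2xy / N`, `u₃ = (|y|² - |x|²) / N` and `v₃ + i w₃
= 2xȳ / N`. -/
theorem isOrientedFrame_spinor {z : Fin 4 → ℝ} (hz : spinorNormSq z ≠ 0) :
    IsOrientedFrame (spinorU z) (spinorV z) (spinorW z) := by
  constructor
  case row =>
    intro j
    fin_cases j <;> simp only [spinorU, spinorV, spinorW, Fin.zero_eta, Fin.mk_one,
      Fin.reduceFinMk, Matrix.cons_val] <;> field_simp <;> rw [spinorNormSq] <;> ring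
  all_goals
    simp only [spinorU, spinorV, spinorW, Matrix.cons_val]
    field_simp
    rw [spinorNormSq]
    ring

namespace IsSpinor

variable {ψ : ℝ → ℂ} {z : ℝ → Fin 4 → ℝ}

theorem ac_mul (h : IsSpinor ψ z) (i j : Fin 4) : ACOnPos fun r => z r i * z r j :=
  (h.ac i).mul (h.ac j)

theorem ac_normSq (h : IsSpinor ψ z) : ACOnPos fun r => spinorNormSq (z r) :=
  ((h.ac_mul 0 0).add (h.ac_mul 1 1)).add ((h.ac_mul 2 2).add (h.ac_mul 3 3))

theorem tendsto_mul (h : IsSpinor ψ z) (i j : Fin 4) :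
    Tendsto (fun r => z r i * z r j) atTop
      (𝓝 ((![0, 0, 1, 0] : Fin 4 → ℝ) i * (![0, 0, 1, 0] : Fin 4 → ℝ) j)) :=
  (h.tendsto i).mul (h.tendsto j)

theorem tendsto_normSq (h : IsSpinor ψ z) :
    Tendsto (fun r => spinorNormSq (z r)) atTop (𝓝 1) := by
  have := ((h.tendsto_mul 0 0).add (h.tendsto_mul 1 1)).add
    ((h.tendsto_mul 2 2).add (h.tendsto_mul 3 3))
  simpa [spinorNormSq] using this

/-- The part of the system containing `ψ` is skew-Hermitian and drops out; the real diagonal part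
does not preserve the norm, hence the normalization in the frame. -/
theorem hasDerivAt_normSq (h : IsSpinor ψ z) :
    ∀ᵐ r ∂(volume.restrict (Ioi (0 : ℝ))), HasDerivAt (fun r => spinorNormSq (z r))
      ((z r 0 * z r 0 + z r 1 * z r 1 - (z r 2 * z r 2 + z r 3 * z r 3)) / Real.sinh r) r := by
  filter_upwards [h.deriv, ae_restrict_mem measurableSet_Ioi] with r hr hr0
  have hs := (Real.sinh_pos_iff.2 hr0).ne'
  refine ((((hr 0).fun_mul (hr 0)).fun_add ((hr 1).fun_mul (hr 1))).fun_add
    (((hr 2).fun_mul (hr 2)).fun_add ((hr 3).fun_mul (hr 3)))).congr_deriv ?_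
  simp only [spinorField, Matrix.cons_val]
  field_simp
  ring

/-- From `N' ≤ N / sinh r`, a zero of `N` would force `N ≤ 0` at all larger radii, contradicting `N
→ 1`. -/
theorem normSq_pos (h : IsSpinor ψ z) {a : ℝ} (ha : 0 < a) : 0 < spinorNormSq (z a) := by
  by_contra hcon
  have hle : ∀ᶠ b in atTop, spinorNormSq (z b) ≤ 0 := by
    filter_upwards [eventually_ge_atTop a] with b hab
    have hk : IntervalIntegrable (fun r => -(Real.sinh r)⁻¹) volume a b :=
      (ContinuousOn.intervalIntegrable_of_pos (Real.continuous_sinh.continuousOn.inv₀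
        fun r hr => (Real.sinh_pos_iff.2 hr).ne') ha hab).neg
    obtain ⟨h1, h2⟩ := h.ac_normSq.integral_exp_mul h.hasDerivAt_normSq ha hab hk
    have h3 : ∫ r in a..b, Real.exp (∫ s in a..r, -(Real.sinh s)⁻¹)
        * ((z r 0 * z r 0 + z r 1 * z r 1 - (z r 2 * z r 2 + z r 3 * z r 3)) / Real.sinh r
          + -(Real.sinh r)⁻¹ * spinorNormSq (z r)) ≤ 0 := by
      refine (intervalIntegral.integral_mono_on (g := fun _ => 0) hab h1
        intervalIntegrable_const ?_).trans_eq intervalIntegral.integral_zero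
      intro r hr
      have hs := inv_pos.2 (Real.sinh_pos_iff.2 (ha.trans_le hr.1))
      refine mul_nonpos_of_nonneg_of_nonpos (Real.exp_pos _).le ?_
      rw [spinorNormSq, div_eq_mul_inv]
      have := mul_nonneg hs.le (add_nonneg (mul_self_nonneg (z r 2)) (mul_self_nonneg (z r 3)))
      linarith
    rw [h2] at h3
    have h4 : Real.exp (∫ s in a..b, -(Real.sinh s)⁻¹) * spinorNormSq (z b) ≤ 0 := by linarith
    exact nonpos_of_mul_nonpos_right h4 (Real.exp_pos _)
  have := le_of_tendsto h.tendsto_normSq hle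
  linarith

/-- After normalization the traceless real diagonal part of the linear system produces precisely the
nonlinear terms `(v₃ + i w₃) / sinh r`, and the spinor `(0, 1)` at infinity corresponds to `u = k`,
`v = i`, `w = j`. -/
theorem frameODE (h : IsSpinor ψ z) :
    FrameODE ψ (fun r => spinorU (z r)) (fun r => spinorV (z r)) (fun r => spinorW (z r)) := by
  have hN := h.ac_normSq.inv fun r hr => h.normSq_pos hr
  have A := h.ac_mul
  have C := fun c : ℝ => ACOnPos.const c
  have tN := h.tendsto_normSq
  have B := h.tendsto_mul
  have T : ∀ {q : ℝ → ℝ} {c d : ℝ}, Tendsto q atTop (𝓝 c) → c = d →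
      Tendsto (fun r => q r / spinorNormSq (z r)) atTop (𝓝 d) := by
    intro q c d hq hcd
    have := hq.div tN one_ne_zero
    rwa [div_one, hcd] at this
  have dN := h.hasDerivAt_normSq
  have hpos : ∀ᵐ r ∂(volume.restrict (Ioi (0 : ℝ))), 0 < r := ae_restrict_mem measurableSet_Ioi
  refine ⟨fun j => ?_, fun j => ?_, fun j => ?_, ?_, ?_, ?_,
    fun r hr => isOrientedFrame_spinor (h.normSq_pos hr).ne', ?_, ?_, ?_⟩
  · fin_cases j
    · exact ((C (-2)).mul ((A 0 2).sub (A 1 3))).mul hN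
    · exact ((C (-2)).mul ((A 0 3).add (A 1 2))).mul hN
    · exact (((A 2 2).add (A 3 3)).sub ((A 0 0).add (A 1 1))).mul hN
  · fin_cases j
    · exact (((A 2 2).sub (A 3 3)).sub ((A 0 0).sub (A 1 1))).mul hN
    · exact ((C 2).mul ((A 2 3).sub (A 0 1))).mul hN
    · exact ((C 2).mul ((A 0 2).add (A 1 3))).mul hN
  · fin_cases j
    · exact ((C (-2)).mul ((A 0 1).add (A 2 3))).mul hN
    · exact (((A 0 0).sub (A 1 1)).add ((A 2 2).sub (A 3 3))).mul hN
    · exact ((C 2).mul ((A 1 2).sub (A 0 3))).mul hN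
  · filter_upwards [h.deriv, dN, hpos] with r hd hn hr j
    have hs := (Real.sinh_pos_iff.2 hr).ne'
    have hz := (h.normSq_pos hr).ne'
    have M := fun i j => (hd i).fun_mul (hd j)
    fin_cases j
    · refine ((((M 0 2).fun_sub (M 1 3)).const_mul (-2)).fun_div hn hz).congr_deriv ?_
      simp only [spinorField, frameRe, frameIm, spinorV, spinorW, Fin.zero_eta, Matrix.cons_val]
      field_simp
      rw [spinorNormSq]
      ring
    · refine ((((M 0 3).fun_add (M 1 2)).const_mul (-2)).fun_div hn hz).congr_deriv ?_
      simp only [spinorField, frameRe, frameIm, spinorV, spinorW, Fin.mk_one, Matrix.cons_val]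
      field_simp
      rw [spinorNormSq]
      ring
    · refine ((((M 2 2).fun_add (M 3 3)).fun_sub ((M 0 0).fun_add (M 1 1))).fun_div hn
        hz).congr_deriv ?_
      simp only [spinorField, frameRe, frameIm, spinorV, spinorW, Fin.reduceFinMk,
        Matrix.cons_val]
      field_simp
      rw [spinorNormSq]
      ring
  · filter_upwards [h.deriv, dN, hpos] with r hd hn hr j
    have hs := (Real.sinh_pos_iff.2 hr).ne'
    have hz := (h.normSq_pos hr).ne'
    have M := fun i j => (hd i).fun_mul (hd j)
    fin_cases j
    · refine ((((M 2 2).fun_sub (M 3 3)).fun_sub ((M 0 0).fun_sub (M 1 1))).fun_div hn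
        hz).congr_deriv ?_
      simp only [spinorField, frameRe, spinorV, spinorU, Fin.zero_eta, Matrix.cons_val]
      field_simp
      rw [spinorNormSq]
      ring
    · refine ((((M 2 3).fun_sub (M 0 1)).const_mul 2).fun_div hn hz).congr_deriv ?_
      simp only [spinorField, frameRe, spinorV, spinorU, Fin.mk_one, Matrix.cons_val]
      field_simp
      rw [spinorNormSq]
      ring
    · refine ((((M 0 2).fun_add (M 1 3)).const_mul 2).fun_div hn hz).congr_deriv ?_
      simp only [spinorField, frameRe, spinorV, spinorU, Fin.reduceFinMk, Matrix.cons_val]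
      field_simp
      rw [spinorNormSq]
      ring
  · filter_upwards [h.deriv, dN, hpos] with r hd hn hr j
    have hs := (Real.sinh_pos_iff.2 hr).ne'
    have hz := (h.normSq_pos hr).ne'
    have M := fun i j => (hd i).fun_mul (hd j)
    fin_cases j
    · refine ((((M 0 1).fun_add (M 2 3)).const_mul (-2)).fun_div hn hz).congr_deriv ?_
      simp only [spinorField, frameIm, spinorW, spinorU, Fin.zero_eta, Matrix.cons_val]
      field_simp
      rw [spinorNormSq]
      ring
    · refine ((((M 0 0).fun_sub (M 1 1)).fun_add ((M 2 2).fun_sub (M 3 3))).fun_div hn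
        hz).congr_deriv ?_
      simp only [spinorField, frameIm, spinorW, spinorU, Fin.mk_one, Matrix.cons_val]
      field_simp
      rw [spinorNormSq]
      ring
    · refine ((((M 1 2).fun_sub (M 0 3)).const_mul 2).fun_div hn hz).congr_deriv ?_
      simp only [spinorField, frameIm, spinorW, spinorU, Fin.reduceFinMk, Matrix.cons_val]
      field_simp
      rw [spinorNormSq]
      ring
  · refine tendsto_pi_nhds.2 fun j => ?_
    fin_cases j
    · exact T (((B 0 2).sub (B 1 3)).const_mul (-2)) (by simp)
    · exact T (((B 0 3).add (B 1 2)).const_mul (-2)) (by simp)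
    · exact T (((B 2 2).add (B 3 3)).sub ((B 0 0).add (B 1 1))) (by simp)
  · refine tendsto_pi_nhds.2 fun j => ?_
    fin_cases j
    · exact T (((B 2 2).sub (B 3 3)).sub ((B 0 0).sub (B 1 1))) (by simp)
    · exact T (((B 2 3).sub (B 0 1)).const_mul 2) (by simp)
    · exact T (((B 0 2).add (B 1 3)).const_mul 2) (by simp)
  · refine tendsto_pi_nhds.2 fun j => ?_
    fin_cases j
    · exact T (((B 0 1).add (B 2 3)).const_mul (-2)) (by simp)
    · exact T (((B 0 0).sub (B 1 1)).add ((B 2 2).sub (B 3 3))) (by simp)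
    · exact T (((B 1 2).sub (B 0 3)).const_mul 2) (by simp)

end IsSpinor

theorem exists_frameODE {ψ : ℝ → ℂ} (hm : AEStronglyMeasurable ψ (volume.restrict (Ioi 0)))
    (hψ : IntegrableOn (weightedSq ψ) (Ioi 0)) : ∃ u v w, FrameODE ψ u v w :=
  let ⟨_, hz⟩ := exists_isSpinor hm hψ
  ⟨_, _, _, hz.frameODE⟩

/-! ### The radial `L²` norm as a weighted integral. -/

theorem ae_radialMeasure_iff {p : ℝ → Prop} :
    (∀ᵐ r ∂radialMeasure, p r) ↔ ∀ᵐ r ∂(volume.restrict (Ioi (0 : ℝ))), p r := by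
  have hm : Measurable fun r => ENNReal.ofReal (Real.sinh r) :=
    ENNReal.measurable_ofReal.comp Real.measurable_sinh
  rw [radialMeasure, ae_withDensity_iff hm]
  have hpos : ∀ᵐ r ∂(volume.restrict (Ioi (0 : ℝ))), 0 < r := ae_restrict_mem measurableSet_Ioi
  refine ⟨fun h => ?_, fun h => ?_⟩
  · filter_upwards [h, hpos] with r hr hr0
    exact hr (ENNReal.ofReal_pos.2 (Real.sinh_pos_iff.2 hr0)).ne'
  · filter_upwards [h] with r hr _ using hr

theorem weightedSq_radialMeasure (f : ℝ → ℂ) :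
    (Integrable (fun r => ‖f r‖ ^ 2) radialMeasure ↔ IntegrableOn (weightedSq f) (Ioi 0)) ∧
      ∫ r, ‖f r‖ ^ 2 ∂radialMeasure = ∫ r in Ioi 0, weightedSq f r := by
  have hm : Measurable fun r => ENNReal.ofReal (Real.sinh r) :=
    ENNReal.measurable_ofReal.comp Real.measurable_sinh
  have hae : ∀ᵐ r ∂(volume.restrict (Ioi (0 : ℝ))),
      (ENNReal.ofReal (Real.sinh r)).toReal = Real.sinh r := by
    filter_upwards [ae_restrict_mem measurableSet_Ioi] with r hr
    exact ENNReal.toReal_ofReal (Real.sinh_pos_iff.2 hr).le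
  constructor
  · rw [radialMeasure, integrable_withDensity_iff hm
      (Eventually.of_forall fun _ => ENNReal.ofReal_lt_top)]
    refine integrable_congr ?_
    filter_upwards [hae] with r hr
    rw [hr, weightedSq]
  · rw [radialMeasure, integral_withDensity_eq_integral_toReal_smul hm
      (Eventually.of_forall fun _ => ENNReal.ofReal_lt_top)]
    refine integral_congr_ae ?_
    filter_upwards [hae] with r hr
    rw [hr, weightedSq, smul_eq_mul, mul_comm]

theorem weightedSq_coe_integrable (ψ : Lp ℂ 2 radialMeasure) :
    IntegrableOn (weightedSq ψ) (Ioi 0) ∧ ∫ r in Ioi 0, weightedSq ψ r = ‖ψ‖ ^ 2 := by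
  have hψ := Lp.memLp ψ
  obtain ⟨h1, h2⟩ := weightedSq_radialMeasure ψ
  refine ⟨h1.1 ((memLp_two_iff_integrable_sq_norm hψ.1).1 hψ), ?_⟩
  rw [← h2, Lp.norm_def, hψ.eLpNorm_eq_integral_rpow_norm two_ne_zero ENNReal.ofNat_ne_top]
  have h0 : 0 ≤ ∫ r, ‖ψ r‖ ^ 2 ∂radialMeasure := integral_nonneg fun _ => sq_nonneg _
  simp only [ENNReal.toReal_ofNat, Real.rpow_ofNat]
  rw [ENNReal.toReal_ofReal (by positivity), ← one_div, ← Real.sqrt_eq_rpow, Real.sq_sqrt h0]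

theorem weightedSq_sub_integrable (ψ ψ' : Lp ℂ 2 radialMeasure) :
    IntegrableOn (weightedSq fun r => ψ r - ψ' r) (Ioi 0) ∧
      ∫ r in Ioi 0, weightedSq (fun r => ψ r - ψ' r) r = ‖ψ - ψ'‖ ^ 2 := by
  obtain ⟨h1, h2⟩ := weightedSq_coe_integrable (ψ - ψ')
  have hae : ∀ᵐ r ∂(volume.restrict (Ioi (0 : ℝ))),
      weightedSq (ψ - ψ' : Lp ℂ 2 radialMeasure) r = weightedSq (fun r => ψ r - ψ' r) r := by
    filter_upwards [ae_radialMeasure_iff.1 (Lp.coeFn_sub ψ ψ')] with r hr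
    rw [weightedSq, hr, weightedSq, Pi.sub_apply]
  exact ⟨h1.congr hae, by rw [← h2]; exact (integral_congr_ae hae).symm⟩

/-! ### Coordinates, rotations and the Dirichlet integral of equivariant maps. -/

theorem hasDerivAt_E3_iff {f : ℝ → E3} {f' : E3} {r : ℝ} :
    HasDerivAt f f' r ↔ ∀ j, HasDerivAt (fun s => f s j) (f' j) r := by
  rw [← hasDerivAt_pi (φ := fun s => (f s).ofLp) (φ' := f'.ofLp)]
  exact ((PiLp.continuousLinearEquiv 2 ℝ fun _ : Fin 3 => ℝ).comp_hasFDerivAt_iff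
    (f := f) (f' := ContinuousLinearMap.toSpanSingleton ℝ f')).symm

theorem E3_norm_sq (x : E3) : ‖x‖ ^ 2 = x 0 ^ 2 + x 1 ^ 2 + x 2 ^ 2 := by
  rw [EuclideanSpace.norm_sq_eq, Fin.sum_univ_three]
  simp only [Real.norm_eq_abs, sq_abs]

theorem E3_inner (x y : E3) : inner ℝ x y = x 0 * y 0 + x 1 * y 1 + x 2 * y 2 := by
  rw [PiLp.inner_apply, Fin.sum_univ_three]
  simp only [RCLike.inner_apply, conj_trivial]
  ring

theorem rot3_zero (x : E3) : rot3 0 x = x := by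
  ext j
  fin_cases j <;> simp [rot3]

theorem E3_norm_rot3 (θ : ℝ) (x : E3) : ‖rot3 θ x‖ ^ 2 = ‖x‖ ^ 2 := by
  simp only [E3_norm_sq, rot3, Matrix.cons_val]
  linear_combination (x 0 ^ 2 + x 1 ^ 2) * Real.sin_sq_add_cos_sq θ

theorem hasDerivAt_rot3_comp {f : ℝ → E3} {f' : E3} {r : ℝ} (θ : ℝ) (hf : HasDerivAt f f' r) :
    HasDerivAt (fun s => rot3 θ (f s)) (rot3 θ f') r := by
  have h := hasDerivAt_E3_iff.1 hf
  refine hasDerivAt_E3_iff.2 fun j => ?_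
  fin_cases j
  · exact ((h 0).const_mul _).fun_sub ((h 1).const_mul _)
  · exact ((h 0).const_mul _).fun_add ((h 1).const_mul _)
  · exact h 2

theorem norm_deriv_rot3_sq (x : E3) (θ : ℝ) :
    ‖deriv (fun t => rot3 t x) θ‖ ^ 2 = x 0 ^ 2 + x 1 ^ 2 := by
  have h : HasDerivAt (fun t => rot3 t x)
      (!₂[-Real.sin θ * x 0 - Real.cos θ * x 1, Real.cos θ * x 0 + -Real.sin θ * x 1, 0] : E3)
      θ := by
    refine hasDerivAt_E3_iff.2 fun j => ?_
    fin_cases j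
    · exact ((Real.hasDerivAt_cos θ).mul_const _).fun_sub ((Real.hasDerivAt_sin θ).mul_const _)
    · exact ((Real.hasDerivAt_sin θ).mul_const _).fun_add ((Real.hasDerivAt_cos θ).mul_const _)
    · exact hasDerivAt_const _ _
  rw [h.deriv, E3_norm_sq]
  simp only [Matrix.cons_val]
  linear_combination (x 0 ^ 2 + x 1 ^ 2) * Real.sin_sq_add_cos_sq θ

theorem polarHyp_eq_rotHyp (r θ : ℝ) : polarHyp r θ = rotHyp θ (polarHyp r 0) := by
  refine Subtype.ext ?_
  ext j
  fin_cases j <;> simp [polarHyp, rotHyp, rot3] <;> ring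

theorem IsOneEquivariant.apply_polarHyp {u : HypPlane → Sphere2} (hu : IsOneEquivariant u)
    (r θ : ℝ) : (u (polarHyp r θ) : E3) = rot3 θ (radialProfile u r) := by
  rw [polarHyp_eq_rotHyp, hu.equivariant]
  rfl

theorem rot3_sub (θ : ℝ) (x y : E3) : rot3 θ (x - y) = rot3 θ x - rot3 θ y := by
  ext j
  fin_cases j <;> simp [rot3] <;> ring

/-- The Dirichlet integral of an equivariant map in terms of its profile. -/
theorem dirichletIntegral_eq {f : HypPlane → E3} {g g' : ℝ → E3}
    (hf : ∀ r θ, f (polarHyp r θ) = rot3 θ (g r))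
    (hg : ∀ᵐ r ∂(volume.restrict (Ioi (0 : ℝ))), HasDerivAt g (g' r) r) :
    dirichletIntegral f = ENNReal.ofReal (2 * Real.pi) * ∫⁻ r in Ioi 0,
      ENNReal.ofReal (Real.sinh r * ‖g' r‖ ^ 2 + (g r 0 ^ 2 + g r 1 ^ 2) / Real.sinh r) := by
  rw [dirichletIntegral, ← lintegral_const_mul' _ _ ENNReal.ofReal_ne_top]
  refine lintegral_congr_ae ?_
  filter_upwards [hg, ae_restrict_mem measurableSet_Ioi] with r hr hr0
  have hs := (Real.sinh_pos_iff.2 hr0).ne'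
  have h : ∀ θ, ENNReal.ofReal
      ((‖deriv (fun s => f (polarHyp s θ)) r‖ ^ 2
        + ‖deriv (fun t => f (polarHyp r t)) θ‖ ^ 2 / Real.sinh r ^ 2) * Real.sinh r)
      = ENNReal.ofReal (Real.sinh r * ‖g' r‖ ^ 2 + (g r 0 ^ 2 + g r 1 ^ 2) / Real.sinh r) := by
    intro θ
    simp only [hf]
    rw [(hasDerivAt_rot3_comp θ hr).deriv, E3_norm_rot3, norm_deriv_rot3_sq]
    congr 1
    field_simp
  simp only [h]
  rw [setLIntegral_const, Real.volume_Ioc, sub_zero, mul_comm]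

/-! ### From an equivariant map with a Coulomb frame to the frame system. -/

theorem isOrientedFrame_of_orthonormal {u v w : Fin 3 → ℝ}
    (huu : u 0 ^ 2 + u 1 ^ 2 + u 2 ^ 2 = 1) (hvv : v 0 ^ 2 + v 1 ^ 2 + v 2 ^ 2 = 1)
    (huv : u 0 * v 0 + u 1 * v 1 + u 2 * v 2 = 0) (w0 : w 0 = u 1 * v 2 - u 2 * v 1)
    (w1 : w 1 = u 2 * v 0 - u 0 * v 2) (w2 : w 2 = u 0 * v 1 - u 1 * v 0) :
    IsOrientedFrame u v w ∧ ∀ (x : Fin 3 → ℝ) (j : Fin 3),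
      x j = (x 0 * u 0 + x 1 * u 1 + x 2 * u 2) * u j
        + (x 0 * v 0 + x 1 * v 1 + x 2 * v 2) * v j
        + (x 0 * w 0 + x 1 * w 1 + x 2 * w 2) * w j := by
  have hww : w 0 ^ 2 + w 1 ^ 2 + w 2 ^ 2 = 1 := by
    rw [w0, w1, w2]
    linear_combination (v 0 ^ 2 + v 1 ^ 2 + v 2 ^ 2) * huu + hvv
      - (u 0 * v 0 + u 1 * v 1 + u 2 * v 2) * huv
  have huw : u 0 * w 0 + u 1 * w 1 + u 2 * w 2 = 0 := by rw [w0, w1, w2]; ring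
  have hvw : v 0 * w 0 + v 1 * w 1 + v 2 * w 2 = 0 := by rw [w0, w1, w2]; ring
  have hM : Matrix.of ![u, v, w] * (Matrix.of ![u, v, w])ᵀ = 1 := by
    ext i j
    rw [Matrix.mul_apply, Fin.sum_univ_three]
    fin_cases i <;> fin_cases j <;> simp <;> linarith
  -- A one-sided inverse of a square matrix is two-sided: orthonormality of `u, v, w` yields the
  -- relations between coordinates and the expansion of any vector.
  have hM' := mul_eq_one_comm.1 hM
  have hent : ∀ i j, u i * u j + v i * v j + w i * w j = (1 : Matrix (Fin 3) (Fin 3) ℝ) i j := by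
    intro i j
    rw [← hM', Matrix.mul_apply, Fin.sum_univ_three]
    simp
  refine ⟨⟨huu, hvv, hww, huv, hvw, fun j => ?_, ?_, ?_, ?_, w0, w1, w2⟩, fun x j => ?_⟩
  · have := hent j j
    rw [Matrix.one_apply_eq] at this
    linarith
  · rw [w1, w2]
    linear_combination (-(u 0)) * hvv + v 0 * huv
  · rw [w0, w2]
    linear_combination (-(u 1)) * hvv + v 1 * huv
  · rw [w0, w1]
    linear_combination (-(u 2)) * hvv + v 2 * huv
  · have h0 := hent 0 j
    have h1 := hent 1 j
    have h2 := hent 2 j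
    have hx : x j = x 0 * (1 : Matrix (Fin 3) (Fin 3) ℝ) 0 j
        + x 1 * (1 : Matrix (Fin 3) (Fin 3) ℝ) 1 j + x 2 * (1 : Matrix (Fin 3) (Fin 3) ℝ) 2 j := by
      fin_cases j <;> simp [Matrix.one_apply]
    rw [hx, ← h0, ← h1, ← h2]
    ring

theorem LocallyACOnPos.coord {f : ℝ → E3} (hf : LocallyACOnPos f) (j : Fin 3) :
    ACOnPos fun r => f r j := by
  have hL : LipschitzOnWith 1 (fun x : E3 => x j) univ := by
    refine (LipschitzWith.of_dist_le_mul fun x y => ?_).lipschitzOnWith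
    rw [dist_eq_norm, dist_eq_norm, NNReal.coe_one, one_mul]
    exact PiLp.norm_apply_le (x - y) j
  exact fun a b ha hab => (hf a b ha hab).lipschitzOn_comp hL (mapsTo_univ _ _)

theorem LocallyACOnPos.of_coord {f : ℝ → E3} (hf : ∀ j, ACOnPos fun r => f r j) :
    LocallyACOnPos f := by
  intro a b ha hab
  have h : ∀ (j : Fin 3) (e : E3), AbsolutelyContinuousOnInterval (fun r => f r j • e) a b :=
    fun j e => (hf j a b ha hab).fun_smul (absolutelyContinuousOnInterval_const e a b)
  refine (((h 0 vecI).fun_add (h 1 vecJ)).fun_add (h 2 vecK)).congr fun r _ => ?_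
  ext j
  fin_cases j <;> simp [vecI, vecJ, vecK]

theorem cross3_zero (a b : E3) : cross3 a b 0 = a 1 * b 2 - a 2 * b 1 := by
  simp [cross3, cross_apply]

theorem cross3_one (a b : E3) : cross3 a b 1 = a 2 * b 0 - a 0 * b 2 := by
  simp [cross3, cross_apply]

theorem cross3_two (a b : E3) : cross3 a b 2 = a 0 * b 1 - a 1 * b 0 := by
  simp [cross3, cross_apply]

/-- The tangential projection of `k` in a frame. -/
theorem inner_cross_cross {u v : E3} (huu : u 0 ^ 2 + u 1 ^ 2 + u 2 ^ 2 = 1)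
    (huv : u 0 * v 0 + u 1 * v 1 + u 2 * v 2 = 0) :
    cross3 u (cross3 vecK u) 0 * v 0 + cross3 u (cross3 vecK u) 1 * v 1
      + cross3 u (cross3 vecK u) 2 * v 2 = v 2 := by
  simp only [cross3_zero, cross3_one, cross3_two, vecK, Matrix.cons_val]
  linear_combination v 2 * huu - u 2 * huv

theorem radialProfile_norm_sq (u : HypPlane → Sphere2) (r : ℝ) :
    radialProfile u r 0 ^ 2 + radialProfile u r 1 ^ 2 + radialProfile u r 2 ^ 2 = 1 := by
  have h : ‖radialProfile u r‖ = 1 := mem_sphere_zero_iff_norm.1 (u (polarHyp r 0)).2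
  rw [← E3_norm_sq, h, one_pow]

/-- A map with its Coulomb frame satisfies the frame system. -/
theorem IsOneEquivariant.exists_frameODE {u : HypPlane → Sphere2} {ψ : ℝ → ℂ}
    (hu : IsOneEquivariant u) (hψ : IsCoulombRepresentation u ψ) :
    ∃ v w : ℝ → E3, FrameODE ψ (fun r => (radialProfile u r).ofLp) (fun r => (v r).ofLp)
      (fun r => (w r).ofLp) := by
  obtain ⟨v, w, hf, hrep⟩ := hψ
  set U := radialProfile u with hU
  have acU := hu.locallyAC.coord
  have acv := hf.locallyAC.coord
  have huu := radialProfile_norm_sq u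
  have hvv : ∀ r, 0 < r → v r 0 ^ 2 + v r 1 ^ 2 + v r 2 ^ 2 = 1 := fun r hr => by
    rw [← E3_norm_sq, hf.unit r hr, one_pow]
  have huv : ∀ r, 0 < r → U r 0 * v r 0 + U r 1 * v r 1 + U r 2 * v r 2 = 0 := fun r hr => by
    rw [← hf.tangent r hr, E3_inner]; ring
  have w0 : ∀ r, 0 < r → w r 0 = U r 1 * v r 2 - U r 2 * v r 1 := fun r hr => by
    rw [hf.oriented r hr, cross3_zero]
  have w1 : ∀ r, 0 < r → w r 1 = U r 2 * v r 0 - U r 0 * v r 2 := fun r hr => by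
    rw [hf.oriented r hr, cross3_one]
  have w2 : ∀ r, 0 < r → w r 2 = U r 0 * v r 1 - U r 1 * v r 0 := fun r hr => by
    rw [hf.oriented r hr, cross3_two]
  have hfr := fun r hr => isOrientedFrame_of_orthonormal (u := (U r).ofLp) (v := (v r).ofLp)
    (w := (w r).ofLp) (huu r) (hvv r hr) (huv r hr) (w0 r hr) (w1 r hr) (w2 r hr)
  have hderiv : ∀ᵐ r ∂(volume.restrict (Ioi (0 : ℝ))), (∀ j, HasDerivAt (fun r => U r j)
        (frameRe ψ (fun r => (v r).ofLp) r * v r j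
          + frameIm ψ (fun r => (w r).ofLp) r * w r j) r) ∧
      (∀ j, HasDerivAt (fun r => v r j) (-(frameRe ψ (fun r => (v r).ofLp) r * U r j)) r) ∧
      ∀ j, HasDerivAt (fun r => w r j) (-(frameIm ψ (fun r => (w r).ofLp) r * U r j)) r := by
    filter_upwards [ae_all_iff.2 fun j => (acU j).ae_differentiableAt,
      ae_all_iff.2 fun j => (acv j).ae_differentiableAt, hf.coulomb, hrep 0,
      ae_restrict_mem measurableSet_Ioi] with r dU dv hc hr hr0
    have hr0 : 0 < r := hr0
    have hs := (Real.sinh_pos_iff.2 hr0).ne'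
    have hev : ∀ᶠ s in 𝓝 r, 0 < s := Ioi_mem_nhds hr0
    obtain ⟨fr, expand⟩ := hfr r hr0
    set a : Fin 3 → ℝ := fun j => deriv (fun r => U r j) r with ha
    set b : Fin 3 → ℝ := fun j => deriv (fun r => v r j) r with hb
    have hUa : ∀ j, HasDerivAt (fun r => U r j) (a j) r := fun j => (dU j).hasDerivAt
    have hvb : ∀ j, HasDerivAt (fun r => v r j) (b j) r := fun j => (dv j).hasDerivAt
    have hUd : deriv U r = WithLp.toLp 2 a := (hasDerivAt_E3_iff.2 hUa).deriv
    have hvd : deriv v r = WithLp.toLp 2 b := (hasDerivAt_E3_iff.2 hvb).deriv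
    -- Differentiating `|u|² = 1`, `|v|² = 1` and `u ⬝ v = 0`, and adding the Coulomb condition,
    -- determines all components of `u'` and `v'` in the frame from those of `u'` along `v` and `w`.
    have e1 : a 0 * U r 0 + a 1 * U r 1 + a 2 * U r 2 = 0 := by
      have h1 := (((hUa 0).fun_pow 2).fun_add ((hUa 1).fun_pow 2)).fun_add ((hUa 2).fun_pow 2)
      have h2 := h1.unique ((hasDerivAt_const r (1 : ℝ)).congr_of_eventuallyEq
        (Eventually.of_forall huu))
      simp only [Nat.cast_ofNat, Nat.add_one_sub_one, pow_one] at h2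
      linarith
    have e2 : b 0 * v r 0 + b 1 * v r 1 + b 2 * v r 2 = 0 := by
      have h1 := (((hvb 0).fun_pow 2).fun_add ((hvb 1).fun_pow 2)).fun_add ((hvb 2).fun_pow 2)
      have h2 := h1.unique ((hasDerivAt_const r (1 : ℝ)).congr_of_eventuallyEq
        (hev.mono hvv))
      simp only [Nat.cast_ofNat, Nat.add_one_sub_one, pow_one] at h2
      linarith
    have e3 : (a 0 * v r 0 + a 1 * v r 1 + a 2 * v r 2)
        + (b 0 * U r 0 + b 1 * U r 1 + b 2 * U r 2) = 0 := by
      have h1 := (((hUa 0).fun_mul (hvb 0)).fun_add ((hUa 1).fun_mul (hvb 1))).fun_add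
        ((hUa 2).fun_mul (hvb 2))
      have h2 := h1.unique ((hasDerivAt_const r (0 : ℝ)).congr_of_eventuallyEq
        (hev.mono huv))
      linarith
    have e4 : b 0 * w r 0 + b 1 * w r 1 + b 2 * w r 2 = 0 := by
      rw [hvd, E3_inner] at hc
      exact hc
    have hfield : ∀ j, fieldVPlus u r 0 j
        = a j + (Real.sinh r)⁻¹ * cross3 (U r) (cross3 vecK (U r)) j := by
      intro j
      have : fieldVPlus u r 0
          = deriv U r + (Real.sinh r)⁻¹ • cross3 (U r) (cross3 vecK (U r)) := rfl
      rw [this, hUd]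
      rfl
    have hα : frameRe ψ (fun r => (v r).ofLp) r
        = a 0 * v r 0 + a 1 * v r 1 + a 2 * v r 2 := by
      have h1 := congrArg Complex.re hr
      simp only [rot3_zero, Complex.add_re, Complex.ofReal_re, Complex.mul_re, Complex.I_re,
        Complex.I_im, Complex.ofReal_im, zero_mul, one_mul, sub_zero, add_zero] at h1
      have h2 := inner_cross_cross (v := v r) (huu r) (huv r hr0)
      rw [E3_inner, hfield, hfield, hfield] at h1
      rw [frameRe, h1]
      linear_combination (Real.sinh r)⁻¹ * h2
    have huw : U r 0 * w r 0 + U r 1 * w r 1 + U r 2 * w r 2 = 0 := by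
      rw [w0 r hr0, w1 r hr0, w2 r hr0]; ring
    have hβ : frameIm ψ (fun r => (w r).ofLp) r
        = a 0 * w r 0 + a 1 * w r 1 + a 2 * w r 2 := by
      have h1 := congrArg Complex.im hr
      simp only [rot3_zero, Complex.add_im, Complex.ofReal_re, Complex.mul_im, Complex.I_re,
        Complex.I_im, Complex.ofReal_im, zero_mul, one_mul, zero_add] at h1
      have h2 := inner_cross_cross (v := w r) (huu r) huw
      rw [E3_inner, hfield, hfield, hfield] at h1
      rw [frameIm, h1]
      linear_combination (Real.sinh r)⁻¹ * h2
    have hae : ∀ j, a j = frameRe ψ (fun r => (v r).ofLp) r * v r j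
        + frameIm ψ (fun r => (w r).ofLp) r * w r j := fun j => by
      rw [hα, hβ]
      linear_combination expand a j + U r j * e1
    have hbe : ∀ j, b j = -(frameRe ψ (fun r => (v r).ofLp) r * U r j) := fun j => by
      rw [hα]
      linear_combination expand b j + v r j * e2 + w r j * e4 + U r j * e3
    refine ⟨fun j => hae j ▸ hUa j, fun j => hbe j ▸ hvb j, fun j => ?_⟩
    fin_cases j
    · refine ((((hUa 1).fun_mul (hvb 2)).fun_sub ((hUa 2).fun_mul
        (hvb 1))).congr_of_eventuallyEq (hev.mono w0)).congr_deriv ?_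
      change _ = -(frameIm ψ (fun r => (w r).ofLp) r * U r 0)
      rw [hae 1, hae 2, hbe 1, hbe 2]
      linear_combination frameIm ψ (fun r => (w r).ofLp) r * fr.cross_zero
    · refine ((((hUa 2).fun_mul (hvb 0)).fun_sub ((hUa 0).fun_mul
        (hvb 2))).congr_of_eventuallyEq (hev.mono w1)).congr_deriv ?_
      change _ = -(frameIm ψ (fun r => (w r).ofLp) r * U r 1)
      rw [hae 0, hae 2, hbe 0, hbe 2]
      linear_combination frameIm ψ (fun r => (w r).ofLp) r * fr.cross_one
    · refine ((((hUa 0).fun_mul (hvb 1)).fun_sub ((hUa 1).fun_mul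
        (hvb 0))).congr_of_eventuallyEq (hev.mono w2)).congr_deriv ?_
      change _ = -(frameIm ψ (fun r => (w r).ofLp) r * U r 2)
      rw [hae 0, hae 1, hbe 0, hbe 1]
      linear_combination frameIm ψ (fun r => (w r).ofLp) r * fr.cross_two
  have tv : Tendsto (fun r => (v r).ofLp) atTop (𝓝 ![1, 0, 0]) :=
    ((PiLp.continuous_ofLp 2 _).tendsto vecI).comp hf.tendsto_v
  have tw : Tendsto (fun r => (w r).ofLp) atTop (𝓝 ![0, 1, 0]) :=
    ((PiLp.continuous_ofLp 2 _).tendsto vecJ).comp hf.tendsto_w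
  refine ⟨v, w, acU, acv, fun j => ?_, hderiv.mono fun r h => h.1, hderiv.mono fun r h => h.2.1,
    hderiv.mono fun r h => h.2.2, fun r hr => (hfr r hr).1, ?_, tv, tw⟩
  · have hw : ∀ {g : ℝ → ℝ}, ACOnPos g → (∀ r, 0 < r → w r j = g r) →
        ACOnPos fun r => w r j := fun hg h a b ha hab =>
      (hg a b ha hab).congr fun x hx => (h x (by
        rw [uIcc_of_le hab] at hx; exact ha.trans_le hx.1)).symm
    fin_cases j
    · exact hw (((acU 1).mul (acv 2)).sub ((acU 2).mul (acv 1))) w0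
    · exact hw (((acU 2).mul (acv 0)).sub ((acU 0).mul (acv 2))) w1
    · exact hw (((acU 0).mul (acv 1)).sub ((acU 1).mul (acv 0))) w2
  · have t1 := tendsto_pi_nhds.1 tv
    have t2 := tendsto_pi_nhds.1 tw
    refine tendsto_pi_nhds.2 fun j => ?_
    have hT : ∀ {g : ℝ → ℝ} {c d : ℝ}, Tendsto g atTop (𝓝 c) → c = d →
        (∀ r, 0 < r → U r j = g r) → Tendsto (fun r => U r j) atTop (𝓝 d) := by
      intro g c d hg hcd h
      rw [← hcd]
      refine hg.congr' ?_
      filter_upwards [eventually_gt_atTop 0] with r hr using (h r hr).symm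
    fin_cases j
    · exact hT (((t1 1).mul (t2 2)).sub ((t1 2).mul (t2 1))) (by simp)
        fun r hr => (hfr r hr).1.cross_zero
    · exact hT (((t1 2).mul (t2 0)).sub ((t1 0).mul (t2 2))) (by simp)
        fun r hr => (hfr r hr).1.cross_one
    · exact hT (((t1 0).mul (t2 1)).sub ((t1 1).mul (t2 0))) (by simp)
        fun r hr => (hfr r hr).1.cross_two

/-! ### From a profile to a continuous equivariant map. -/

/-- The radius `sinh r` of a point of the hyperbolic plane. -/
noncomputable def hypRadius (x : HypPlane) : ℝ := √(x.1 0 ^ 2 + x.1 1 ^ 2)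

theorem hypRadius_sq (x : HypPlane) : hypRadius x ^ 2 = x.1 0 ^ 2 + x.1 1 ^ 2 :=
  Real.sq_sqrt (by positivity)

theorem continuous_hypRadius : Continuous hypRadius := by
  unfold hypRadius
  fun_prop

theorem hypRadius_rotHyp (θ : ℝ) (x : HypPlane) : hypRadius (rotHyp θ x) = hypRadius x := by
  rw [hypRadius, hypRadius]
  congr 1
  simp only [rotHyp, rot3, Matrix.cons_val]
  linear_combination (x.1 0 ^ 2 + x.1 1 ^ 2) * Real.sin_sq_add_cos_sq θ

theorem hypRadius_polarHyp {r : ℝ} (hr : 0 ≤ r) (θ : ℝ) :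
    hypRadius (polarHyp r θ) = Real.sinh r := by
  rw [hypRadius, ← Real.sqrt_sq (Real.sinh_nonneg_iff.2 hr)]
  congr 1
  simp only [polarHyp, Matrix.cons_val]
  linear_combination Real.sinh r ^ 2 * Real.sin_sq_add_cos_sq θ

theorem exists_eq_polarHyp (x : HypPlane) : ∃ r θ, 0 ≤ r ∧ x = polarHyp r θ := by
  have hρ : 0 ≤ hypRadius x := Real.sqrt_nonneg _
  set ζ : ℂ := ⟨x.1 0, x.1 1⟩ with hζ
  have hn : ‖ζ‖ = hypRadius x := by
    rw [hypRadius, ← Real.sqrt_sq (norm_nonneg ζ), ← Complex.normSq_eq_norm_sq,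
      Complex.normSq_apply]
    congr 1
    simp only [hζ]
    ring
  refine ⟨Real.arsinh (hypRadius x), ζ.arg, Real.arsinh_nonneg_iff.2 hρ, Subtype.ext ?_⟩
  have h2 : x.1 2 = Real.cosh (Real.arsinh (hypRadius x)) := by
    rw [Real.cosh_arsinh, hypRadius_sq, ← Real.sqrt_sq x.2.2.le]
    congr 1
    linarith [x.2.1]
  ext j
  fin_cases j
  · change x.1 0 = Real.sinh (Real.arsinh (hypRadius x)) * Real.cos ζ.arg
    rw [Real.sinh_arsinh, ← hn, Complex.norm_mul_cos_arg]
  · change x.1 1 = Real.sinh (Real.arsinh (hypRadius x)) * Real.sin ζ.arg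
    rw [Real.sinh_arsinh, ← hn, Complex.norm_mul_sin_arg]
  · simpa [polarHyp] using h2

theorem continuous_polarHyp (θ : ℝ) : Continuous fun r => polarHyp r θ := by
  refine Continuous.subtype_mk ((PiLp.continuous_toLp 2 _).comp (continuous_pi fun j => ?_)) _
  fin_cases j
  · exact Real.continuous_sinh.mul continuous_const
  · exact Real.continuous_sinh.mul continuous_const
  · exact Real.continuous_cosh

/-- Equivariant maps are determined by their profile on `(0, ∞)`. -/
theorem IsOneEquivariant.ext {u u' : HypPlane → Sphere2} (hu : IsOneEquivariant u)
    (hu' : IsOneEquivariant u') (h : ∀ r, 0 < r → radialProfile u r = radialProfile u' r) :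
    u = u' := by
  funext x
  obtain ⟨r, θ, hr, rfl⟩ := exists_eq_polarHyp x
  have heq : EqOn (fun r => u (polarHyp r θ)) (fun r => u' (polarHyp r θ)) (Ioi 0) :=
    fun s hs => Subtype.ext (by rw [hu.apply_polarHyp, hu'.apply_polarHyp, h s hs])
  have hcl := heq.closure (hu.continuous.comp (continuous_polarHyp θ))
    (hu'.continuous.comp (continuous_polarHyp θ))
  rw [closure_Ioi] at hcl
  exact hcl hr

/-- The equivariant map with a given profile. -/
noncomputable def mapOfProfile (g : ℝ → Fin 3 → ℝ) (x : HypPlane) : E3 :=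
  if hypRadius x = 0 then vecK else
    !₂[(x.1 0 * g (Real.arsinh (hypRadius x)) 0 - x.1 1 * g (Real.arsinh (hypRadius x)) 1)
        / hypRadius x,
      (x.1 1 * g (Real.arsinh (hypRadius x)) 0 + x.1 0 * g (Real.arsinh (hypRadius x)) 1)
        / hypRadius x, g (Real.arsinh (hypRadius x)) 2]

section MapOfProfile

variable {g : ℝ → Fin 3 → ℝ}

theorem norm_mapOfProfile (hg : ∀ r, 0 < r → g r 0 ^ 2 + g r 1 ^ 2 + g r 2 ^ 2 = 1)
    (x : HypPlane) : ‖mapOfProfile g x‖ = 1 := by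
  rw [← sq_eq_sq₀ (norm_nonneg _) zero_le_one, one_pow, E3_norm_sq, mapOfProfile]
  split_ifs with h
  · simp [vecK]
  · have hpos : 0 < hypRadius x := lt_of_le_of_ne (Real.sqrt_nonneg _) (Ne.symm h)
    have h1 := hg _ (Real.arsinh_pos_iff.2 hpos)
    have h2 := hypRadius_sq x
    simp only [Matrix.cons_val]
    field_simp
    linear_combination hypRadius x ^ 2 * h1
      - (g (Real.arsinh (hypRadius x)) 0 ^ 2 + g (Real.arsinh (hypRadius x)) 1 ^ 2) * h2

theorem mapOfProfile_rotHyp (θ : ℝ) (x : HypPlane) :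
    mapOfProfile g (rotHyp θ x) = rot3 θ (mapOfProfile g x) := by
  rw [mapOfProfile, mapOfProfile, hypRadius_rotHyp]
  split_ifs with h
  · ext j
    fin_cases j <;> simp [rot3, vecK]
  · ext j
    fin_cases j <;> simp [rot3, rotHyp] <;> field_simp <;> ring

theorem mapOfProfile_polarHyp {r : ℝ} (hr : 0 < r) :
    mapOfProfile g (polarHyp r 0) = WithLp.toLp 2 (g r) := by
  have hs := (Real.sinh_pos_iff.2 hr).ne'
  rw [mapOfProfile, hypRadius_polarHyp hr.le, if_neg hs, Real.arsinh_sinh]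
  ext j
  fin_cases j <;> simp [polarHyp, hs]

theorem continuous_mapOfProfile (hg : ∀ r, 0 < r → g r 0 ^ 2 + g r 1 ^ 2 + g r 2 ^ 2 = 1)
    (hc : ∀ j, ContinuousOn (fun r => g r j) (Ioi 0))
    (h0 : Tendsto (fun r => g r 2) (𝓝[>] 0) (𝓝 1)) : Continuous (mapOfProfile g) := by
  rw [continuous_iff_continuousAt]
  intro x
  rcases (Real.sqrt_nonneg _ : 0 ≤ hypRadius x).eq_or_lt with hx | hx
  · have hthird : Tendsto (fun y => mapOfProfile g y 2) (𝓝 x) (𝓝 1) := by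
      intro s hs
      obtain ⟨δ, hδ, hsub⟩ := mem_nhdsGT_iff_exists_Ioo_subset.1 (h0 hs)
      have hlt : ∀ᶠ y in 𝓝 x, hypRadius y < Real.sinh δ :=
        continuous_hypRadius.continuousAt.eventually_lt continuousAt_const
          (hx.symm.trans_lt (Real.sinh_pos_iff.2 hδ))
      rw [mem_map]
      filter_upwards [hlt] with y hy
      change mapOfProfile g y 2 ∈ s
      rw [mapOfProfile]
      split_ifs with h
      · simpa [vecK] using mem_of_mem_nhds hs
      · have hpos : 0 < hypRadius y := lt_of_le_of_ne (Real.sqrt_nonneg _) (Ne.symm h)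
        refine hsub (a := Real.arsinh (hypRadius y)) ⟨Real.arsinh_pos_iff.2 hpos, ?_⟩
        rw [← Real.arsinh_sinh δ]
        exact Real.arsinh_lt_arsinh.2 hy
    have hval : mapOfProfile g x = vecK := if_pos hx.symm
    rw [ContinuousAt, hval, tendsto_iff_norm_sub_tendsto_zero]
    -- On the unit sphere the distance to `k` depends only on the third coordinate, so convergence
    -- of `u₃` suffices for continuity at the origin.
    have hnorm : ∀ y, ‖mapOfProfile g y - vecK‖ = √(2 - 2 * mapOfProfile g y 2) := by
      intro y
      have h1 := E3_norm_sq (mapOfProfile g y)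
      rw [norm_mapOfProfile hg] at h1
      rw [← Real.sqrt_sq (norm_nonneg (mapOfProfile g y - vecK)), E3_norm_sq]
      congr 1
      simp only [vecK, PiLp.sub_apply, Matrix.cons_val]
      linarith
    simp only [hnorm]
    have h2 := (Real.continuous_sqrt.tendsto _).comp ((hthird.const_mul 2).const_sub 2)
    norm_num at h2
    exact h2
  · have hr : 0 < Real.arsinh (hypRadius x) := Real.arsinh_pos_iff.2 hx
    have hgc : ∀ j, ContinuousAt (fun y => g (Real.arsinh (hypRadius y)) j) x := fun j =>
      ContinuousAt.comp (f := fun y => Real.arsinh (hypRadius y)) (g := fun r => g r j)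
        ((hc j).continuousAt (Ioi_mem_nhds hr))
        (Real.continuous_arsinh.comp continuous_hypRadius).continuousAt
    have hxc : ∀ j, ContinuousAt (fun y : HypPlane => y.1 j) x := fun j => by fun_prop
    have hρ := continuous_hypRadius.continuousAt (x := x)
    have hev : ∀ᶠ y in 𝓝 x, hypRadius y ≠ 0 := hρ.eventually_ne hx.ne'
    refine ContinuousAt.congr (f := fun y : HypPlane => (WithLp.toLp 2
      ![(y.1 0 * g (Real.arsinh (hypRadius y)) 0 - y.1 1 * g (Real.arsinh (hypRadius y)) 1)
        / hypRadius y,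
      (y.1 1 * g (Real.arsinh (hypRadius y)) 0 + y.1 0 * g (Real.arsinh (hypRadius y)) 1)
        / hypRadius y, g (Real.arsinh (hypRadius y)) 2] : E3)) ?_
      (hev.mono fun y hy => (if_neg hy).symm)
    refine (PiLp.continuous_toLp 2 _).continuousAt.comp (continuousAt_pi.2 fun j => ?_)
    fin_cases j
    · exact (((hxc 0).mul (hgc 0)).sub ((hxc 1).mul (hgc 1))).div hρ hx.ne'
    · exact (((hxc 1).mul (hgc 0)).add ((hxc 0).mul (hgc 1))).div hρ hx.ne'
    · exact hgc 2

end MapOfProfile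

theorem cross3_rot3 (θ : ℝ) (x y : E3) :
    cross3 (rot3 θ x) (rot3 θ y) = rot3 θ (cross3 x y) := by
  have h := Real.sin_sq_add_cos_sq θ
  ext j
  fin_cases j
  · change cross3 _ _ 0 = _
    rw [cross3_zero]
    change _ = Real.cos θ * cross3 x y 0 - Real.sin θ * cross3 x y 1
    simp only [cross3_zero, cross3_one, rot3, Matrix.cons_val]
    ring
  · change cross3 _ _ 1 = _
    rw [cross3_one]
    change _ = Real.sin θ * cross3 x y 0 + Real.cos θ * cross3 x y 1
    simp only [cross3_zero, cross3_one, rot3, Matrix.cons_val]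
    ring
  · change cross3 _ _ 2 = cross3 x y 2
    simp only [cross3_two, rot3, Matrix.cons_val]
    linear_combination (x 0 * y 1 - x 1 * y 0) * h

theorem inner_rot3 (θ : ℝ) (x y : E3) : inner ℝ (rot3 θ x) (rot3 θ y) = inner ℝ x y := by
  simp only [E3_inner, rot3, Matrix.cons_val]
  linear_combination (x 0 * y 0 + x 1 * y 1) * Real.sin_sq_add_cos_sq θ

theorem rot3_add_smul (θ c : ℝ) (x y : E3) : rot3 θ x + c • rot3 θ y = rot3 θ (x + c • y) := by
  ext j
  fin_cases j <;> simp [rot3] <;> ring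

theorem rot3_vecK (θ : ℝ) : rot3 θ vecK = vecK := by
  ext j
  fin_cases j <;> simp [rot3, vecK]

/-- A solution of the frame system is the profile and Coulomb frame of an equivariant map. -/
theorem FrameODE.exists_map {ψ : ℝ → ℂ} {U V W : ℝ → Fin 3 → ℝ} (h : FrameODE ψ U V W)
    (hψ : IntegrableOn (weightedSq ψ) (Ioi 0)) (hM : ∫ r in Ioi 0, weightedSq ψ r < 4) :
    ∃ u : HypPlane → Sphere2, IsOneEquivariant u ∧ IsCoulombRepresentation u ψ := by
  have hg : ∀ r, 0 < r → U r 0 ^ 2 + U r 1 ^ 2 + U r 2 ^ 2 = 1 := fun r hr => (h.frame r hr).uu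
  set u : HypPlane → Sphere2 := fun x =>
    ⟨mapOfProfile U x, mem_sphere_zero_iff_norm.2 (norm_mapOfProfile hg x)⟩ with hu
  have hprof : ∀ r, 0 < r → radialProfile u r = WithLp.toLp 2 (U r) := fun r hr =>
    mapOfProfile_polarHyp hr
  have hequi : IsOneEquivariant u := by
    refine ⟨fun θ x => mapOfProfile_rotHyp θ x, (continuous_mapOfProfile hg
      (fun j => (h.ac_u j).continuousOn) (h.tendsto_u_zero hψ hM)).subtype_mk _, ?_⟩
    refine LocallyACOnPos.of_coord fun j a b ha hab => (h.ac_u j a b ha hab).congr fun r hr => ?_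
    rw [uIcc_of_le hab] at hr
    rw [hprof r (ha.trans_le hr.1)]
  refine ⟨u, hequi, fun r => WithLp.toLp 2 (V r), fun r => WithLp.toLp 2 (W r), ?_, ?_⟩
  · refine ⟨LocallyACOnPos.of_coord h.ac_v, fun r hr => ?_, fun r hr => ?_, fun r hr => ?_, ?_,
      ((PiLp.continuous_toLp 2 _).tendsto _).comp h.tendsto_v,
      ((PiLp.continuous_toLp 2 _).tendsto _).comp h.tendsto_w⟩
    · rw [← sq_eq_sq₀ (norm_nonneg _) zero_le_one, one_pow, E3_norm_sq]
      exact (h.frame r hr).vv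
    · rw [hprof r hr, E3_inner]
      linarith [(h.frame r hr).uv]
    · rw [hprof r hr]
      ext j
      fin_cases j
      · change W r 0 = cross3 (WithLp.toLp 2 (U r)) (WithLp.toLp 2 (V r)) 0
        rw [cross3_zero]
        exact (h.frame r hr).w_zero
      · change W r 1 = cross3 (WithLp.toLp 2 (U r)) (WithLp.toLp 2 (V r)) 1
        rw [cross3_one]
        exact (h.frame r hr).w_one
      · change W r 2 = cross3 (WithLp.toLp 2 (U r)) (WithLp.toLp 2 (V r)) 2
        rw [cross3_two]
        exact (h.frame r hr).w_two
    · filter_upwards [h.deriv_v, ae_restrict_mem measurableSet_Ioi] with r hr hr0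
      have hd : HasDerivAt (fun r => (WithLp.toLp 2 (V r) : E3))
          (WithLp.toLp 2 fun j => -(frameRe ψ V r * U r j)) r := hasDerivAt_E3_iff.2 hr
      have fr := h.frame r hr0
      rw [hd.deriv, E3_inner]
      simp only [fr.w_zero, fr.w_one, fr.w_two]
      ring
  · intro θ
    filter_upwards [h.deriv_u, ae_restrict_mem measurableSet_Ioi] with r hr hr0
    have hr0 : 0 < r := hr0
    have fr := h.frame r hr0
    have hs := (Real.sinh_pos_iff.2 hr0).ne'
    set a : E3 := WithLp.toLp 2 fun j => frameRe ψ V r * V r j + frameIm ψ W r * W r j with ha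
    have hd : HasDerivAt (radialProfile u) a r := by
      refine (hasDerivAt_E3_iff (f := fun r => WithLp.toLp 2 (U r)) (f' := a).2
        hr).congr_of_eventuallyEq ?_
      filter_upwards [Ioi_mem_nhds hr0] with s hs using hprof s hs
    -- Rotations about `k` commute with the cross product and fix `k`, so the field at angle `θ` is
    -- the rotated field at angle `0`.
    have hfield : fieldVPlus u r θ = rot3 θ (a + (Real.sinh r)⁻¹ •
        cross3 (radialProfile u r) (cross3 vecK (radialProfile u r))) := by
      have h1 : (fun s => (u (polarHyp s θ) : E3)) = fun s => rot3 θ (radialProfile u s) := by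
        funext s
        exact hequi.apply_polarHyp s θ
      rw [fieldVPlus, h1, (hasDerivAt_rot3_comp θ hd).deriv, hequi.apply_polarHyp,
        ← rot3_add_smul, ← cross3_rot3, ← cross3_rot3, rot3_vecK]
    have key : ∀ x : E3, U r 0 * x 0 + U r 1 * x 1 + U r 2 * x 2 = 0 →
        inner ℝ (fieldVPlus u r θ) (rot3 θ x)
          = a 0 * x 0 + a 1 * x 1 + a 2 * x 2 + (Real.sinh r)⁻¹ * x 2 := by
      intro x hx
      have h2 := inner_cross_cross (u := WithLp.toLp 2 (U r)) (v := x) fr.uu hx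
      rw [hfield, inner_rot3, E3_inner, hprof r hr0]
      simp only [PiLp.add_apply, PiLp.smul_apply, smul_eq_mul]
      linear_combination (Real.sinh r)⁻¹ * h2
    have huw : U r 0 * W r 0 + U r 1 * W r 1 + U r 2 * W r 2 = 0 := by
      rw [fr.w_zero, fr.w_one, fr.w_two]; ring
    have hv : inner ℝ (fieldVPlus u r θ) (rot3 θ (WithLp.toLp 2 (V r))) = (ψ r).re := by
      rw [key _ fr.uv]
      have e : frameRe ψ V r = (ψ r).re - V r 2 * (Real.sinh r)⁻¹ := by
        rw [frameRe, div_eq_mul_inv]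
      simp only [ha]
      linear_combination frameRe ψ V r * fr.vv + frameIm ψ W r * fr.vw + e
    have hw : inner ℝ (fieldVPlus u r θ) (rot3 θ (WithLp.toLp 2 (W r))) = (ψ r).im := by
      rw [key _ huw]
      have e : frameIm ψ W r = (ψ r).im - W r 2 * (Real.sinh r)⁻¹ := by
        rw [frameIm, div_eq_mul_inv]
      simp only [ha]
      linear_combination frameIm ψ W r * fr.ww + frameRe ψ V r * fr.vw + e
    rw [hv, hw, mul_comm Complex.I, Complex.re_add_im]

/-! ### Energy, distance and uniqueness of the maps, and the conclusion. -/

theorem FrameODE.energyDensity_eq {ψ : ℝ → ℂ} {U V W : ℝ → Fin 3 → ℝ} (h : FrameODE ψ U V W)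
    {r : ℝ} (hr : 0 < r) :
    Real.sinh r * ‖(WithLp.toLp 2 fun j => frameRe ψ V r * V r j + frameIm ψ W r * W r j : E3)‖ ^ 2
      + (U r 0 ^ 2 + U r 1 ^ 2) / Real.sinh r = frameEnergy ψ V W r := by
  have fr := h.frame r hr
  rw [E3_norm_sq, frameEnergy, show U r 0 ^ 2 + U r 1 ^ 2 = V r 2 ^ 2 + W r 2 ^ 2 by
    linarith [fr.uu, fr.row 2]]
  simp only
  linear_combination Real.sinh r * (frameRe ψ V r ^ 2 * fr.vv + frameIm ψ W r ^ 2 * fr.ww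
    + 2 * frameRe ψ V r * frameIm ψ W r * fr.vw)

theorem IsOneEquivariant.mapEnergy_eq {u : HypPlane → Sphere2} {ψ : ℝ → ℂ} {v w : ℝ → E3}
    (hu : IsOneEquivariant u) (h : FrameODE ψ (fun r => (radialProfile u r).ofLp)
      (fun r => (v r).ofLp) fun r => (w r).ofLp)
    (hψ : IntegrableOn (weightedSq ψ) (Ioi 0)) (hM : ∫ r in Ioi 0, weightedSq ψ r < 4) :
    mapEnergy u = ENNReal.ofReal (Real.pi * ∫ r in Ioi 0, weightedSq ψ r) := by
  have hint := (h.integrable_frameEnergy hψ hM).1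
  have h0 : 0 ≤ ∫ r in Ioi 0, weightedSq ψ r :=
    setIntegral_nonneg measurableSet_Ioi fun r => weightedSq_nonneg ψ
  rw [mapEnergy, dirichletIntegral_eq (g' := fun r => (WithLp.toLp 2 fun j =>
      frameRe ψ (fun r => (v r).ofLp) r * v r j + frameIm ψ (fun r => (w r).ofLp) r * w r j : E3))
      hu.apply_polarHyp (h.deriv_u.mono fun r hr => hasDerivAt_E3_iff.2 hr),
    setLIntegral_congr_fun measurableSet_Ioi fun r hr =>
      congrArg ENNReal.ofReal (h.energyDensity_eq hr),
    ← ofReal_integral_eq_lintegral_ofReal hint (by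
      filter_upwards [ae_restrict_mem measurableSet_Ioi] with r hr using
        frameEnergy_nonneg ψ _ _ hr),
    h.integral_frameEnergy_eq hψ hM, ← ENNReal.ofReal_mul (by positivity),
    show (2⁻¹ : ℝ≥0∞) = ENNReal.ofReal 2⁻¹ by
      rw [ENNReal.ofReal_inv_of_pos two_pos, ENNReal.ofReal_ofNat],
    ← ENNReal.ofReal_mul (by norm_num)]
  congr 1
  ring

theorem IsOneEquivariant.dotH1Dist_le {u u' : HypPlane → Sphere2} {ψ ψ' : ℝ → ℂ}
    {v w v' w' : ℝ → E3} (hu : IsOneEquivariant u) (hu' : IsOneEquivariant u')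
    (h : FrameODE ψ (fun r => (radialProfile u r).ofLp) (fun r => (v r).ofLp)
      fun r => (w r).ofLp)
    (h' : FrameODE ψ' (fun r => (radialProfile u' r).ofLp) (fun r => (v' r).ofLp)
      fun r => (w' r).ofLp)
    (hψ : IntegrableOn (weightedSq ψ) (Ioi 0)) (hM : ∫ r in Ioi 0, weightedSq ψ r < 4)
    (hψ' : IntegrableOn (weightedSq ψ') (Ioi 0)) (hM' : ∫ r in Ioi 0, weightedSq ψ' r < 4)
    (hD : IntegrableOn (weightedSq fun r => ψ r - ψ' r) (Ioi 0)) :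
    dotH1Dist u u' ≤ ENNReal.ofReal (√(2 * Real.pi * frameDistConst)
      * √(∫ r in Ioi 0, weightedSq (fun r => ψ r - ψ' r) r)) := by
  set δ := ∫ r in Ioi 0, weightedSq (fun r => ψ r - ψ' r) r
  have hc : 0 ≤ frameDistConst := by unfold frameDistConst; positivity
  have hδ : 0 ≤ δ := setIntegral_nonneg measurableSet_Ioi fun r => weightedSq_nonneg _
  have hdir := dirichletIntegral_eq (f := fun x => (u x : E3) - (u' x : E3))
    (g := fun r => radialProfile u r - radialProfile u' r)
    (g' := fun r => (WithLp.toLp 2 fun j =>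
      frameRe ψ (fun r => (v r).ofLp) r * v r j + frameIm ψ (fun r => (w r).ofLp) r * w r j
      - (frameRe ψ' (fun r => (v' r).ofLp) r * v' r j
        + frameIm ψ' (fun r => (w' r).ofLp) r * w' r j) : E3))
    (fun r θ => by rw [hu.apply_polarHyp, hu'.apply_polarHyp, rot3_sub])
    (by
      filter_upwards [h.deriv_u, h'.deriv_u] with r h1 h2
      exact hasDerivAt_E3_iff.2 fun j => (h1 j).fun_sub (h2 j))
  have hle : dirichletIntegral (fun x => (u x : E3) - (u' x : E3))
      ≤ ENNReal.ofReal (2 * Real.pi * frameDistConst * δ) := by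
    rw [hdir, mul_assoc (2 * Real.pi),
      ENNReal.ofReal_mul (p := 2 * Real.pi) (q := frameDistConst * δ) (by positivity)]
    refine mul_le_mul_right ((lintegral_congr fun r => ?_).trans_le
      (h.integral_frameDistDensity_le h' hψ hM hψ' hM' hD)) _
    rw [frameDistDensity, E3_norm_sq, Fin.sum_univ_three]
    rfl
  rw [dotH1Dist, ← Real.sqrt_mul (by positivity), Real.sqrt_eq_rpow,
    ← ENNReal.ofReal_rpow_of_nonneg (by positivity) (by norm_num)]
  exact ENNReal.rpow_le_rpow hle (by norm_num)

/-- With `ψ - ψ = 0` both pointwise stability bounds have right-hand side zero, so the profiles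
agree on `(0, ∞)`; continuity settles the origin. -/
theorem eq_of_isCoulombRepresentation {u u' : HypPlane → Sphere2} {ψ : ℝ → ℂ}
    (hu : IsOneEquivariant u) (hu' : IsOneEquivariant u') (h : IsCoulombRepresentation u ψ)
    (h' : IsCoulombRepresentation u' ψ) (hψ : IntegrableOn (weightedSq ψ) (Ioi 0))
    (hM : ∫ r in Ioi 0, weightedSq ψ r < 4) : u = u' := by
  obtain ⟨v, w, hf⟩ := hu.exists_frameODE h
  obtain ⟨v', w', hf'⟩ := hu'.exists_frameODE h'
  have hz : weightedSq (fun r => ψ r - ψ r) = fun _ => 0 := by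
    funext r
    simp [weightedSq]
  have hD : IntegrableOn (weightedSq fun r => ψ r - ψ r) (Ioi 0) := by
    rw [hz]
    exact integrableOn_zero
  refine hu.ext hu' fun r hr => ?_
  have h1 := hf.vertical_diff_bound hf' hψ hM hψ hM hD hr le_rfl
  have h2 := hf.horizontal_diff_bound hf' hψ hM hψ hM hD hr
  simp only [hz, integral_zero, mul_zero, intervalIntegral.integral_same, add_zero,
    frameDiffSq] at h1 h2
  ext j
  refine sub_eq_zero.1 (pow_eq_zero_iff two_ne_zero |>.1 (le_antisymm ?_ (sq_nonneg _)))
  fin_cases j <;> simp only [Fin.zero_eta, Fin.mk_one, Fin.reduceFinMk]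
  · refine le_trans ?_ h2
    have : ∀ a b c d e f : ℝ, a ^ 2 ≤ a ^ 2 + b ^ 2 + c ^ 2 + (d ^ 2 + e ^ 2 + f ^ 2) :=
      fun a b c d e f => by nlinarith
    exact this _ _ _ _ _ _
  · refine le_trans ?_ h2
    have : ∀ a b c d e f : ℝ, d ^ 2 ≤ a ^ 2 + b ^ 2 + c ^ 2 + (d ^ 2 + e ^ 2 + f ^ 2) :=
      fun a b c d e f => by nlinarith
    exact this _ _ _ _ _ _
  · refine le_trans ?_ h1
    have : ∀ a b c : ℝ, a ^ 2 ≤ a ^ 2 + b ^ 2 + c ^ 2 := fun a b c => by nlinarith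
    exact this _ _ _

theorem mainTheorem7 :
    (∀ ψ : Lp ℂ 2 radialMeasure, ‖ψ‖ < 2 →
      ∃! u : HypPlane → Sphere2, IsOneEquivariant u ∧ IsCoulombRepresentation u ψ) ∧
    (∀ ψ : Lp ℂ 2 radialMeasure, ‖ψ‖ < 2 →
      ∀ u : HypPlane → Sphere2, IsOneEquivariant u → IsCoulombRepresentation u ψ →
        InClassE0 u ∧ mapEnergy u = ENNReal.ofReal (Real.pi * ‖ψ‖ ^ 2)) ∧
    (∃ C : ℝ, 0 < C ∧
      ∀ ψ ψ' : Lp ℂ 2 radialMeasure, ‖ψ‖ < 2 → ‖ψ'‖ < 2 →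
        ∀ u u' : HypPlane → Sphere2,
          IsOneEquivariant u → IsCoulombRepresentation u ψ →
          IsOneEquivariant u' → IsCoulombRepresentation u' ψ' →
            dotH1Dist u u' ≤ ENNReal.ofReal (C * ‖ψ - ψ'‖)) := by
  have hlt : ∀ ψ : Lp ℂ 2 radialMeasure, ‖ψ‖ < 2 → ∫ r in Ioi 0, weightedSq ψ r < 4 := by
    intro ψ hψ
    rw [(weightedSq_coe_integrable ψ).2]
    nlinarith [norm_nonneg ψ]
  refine ⟨fun ψ hn => ?_, fun ψ hn u hu hrep => ?_, √(2 * Real.pi * frameDistConst), ?_,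
    fun ψ ψ' hn hn' u u' hu hrep hu' hrep' => ?_⟩
  · have hψ := (weightedSq_coe_integrable ψ).1
    obtain ⟨U, V, W, h⟩ := exists_frameODE (Lp.stronglyMeasurable ψ).aestronglyMeasurable hψ
    obtain ⟨u, hu, hrep⟩ := h.exists_map hψ (hlt ψ hn)
    exact ⟨u, ⟨hu, hrep⟩, fun u' hu' =>
      eq_of_isCoulombRepresentation hu'.1 hu hu'.2 hrep hψ (hlt ψ hn)⟩
  · obtain ⟨hψ, hval⟩ := weightedSq_coe_integrable ψ
    obtain ⟨v, w, h⟩ := hu.exists_frameODE hrep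
    have hE := hu.mapEnergy_eq h hψ (hlt ψ hn)
    rw [hval] at hE
    exact ⟨⟨hE ▸ ENNReal.ofReal_lt_top, h.tendsto_u_zero hψ (hlt ψ hn), h.tendsto_u_two⟩, hE⟩
  · have : 0 < frameDistConst := by unfold frameDistConst; positivity
    positivity
  · obtain ⟨hψ, -⟩ := weightedSq_coe_integrable ψ
    obtain ⟨hψ', -⟩ := weightedSq_coe_integrable ψ'
    obtain ⟨hD, hval⟩ := weightedSq_sub_integrable ψ ψ'
    obtain ⟨v, w, h⟩ := hu.exists_frameODE hrep
    obtain ⟨v', w', h'⟩ := hu'.exists_frameODE hrep'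
    have := hu.dotH1Dist_le hu' h h' hψ (hlt ψ hn) hψ' (hlt ψ' hn') hD
    rwa [hval, Real.sqrt_sq (norm_nonneg _)] at this
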